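/- **Setting.** Let $D$ be a probability distribution on a measurable space $X$. Statistical queries are measurable functions $q:X\to[0,1]$, taken from an arbitrary class $\{q_\theta\}_{\theta\in\Theta}$ for which $(\theta,x)\mapsto q_\theta(x)$ is jointly measurable; write $\mathbb E[q]=\mathbb E_{x\sim D}[q(x)]$ and $\mathcal E_S[q]=\frac1{|S|}\sum_{x\in S}q(x)$. A sequence of querying rules consists of measurable maps $R_i$ $(i\ge 0)$ which choose the next query $q_i=R_i\big(u;(q_0,a_0,c_0),\dots,(q_{i-1},a_{i-1},c_{i-1})\big)$ from all earlier queries, answers $a_j$ and prices $c_j$ and from a random seed $u$ (with an arbitrary law, independent of the mechanism and of the data). **Mechanism.** For $\tau,\beta,p\in(0,1)$ and an initial budget parameter $n>0$ put, for $t=0,1,2,\dots$, $$N_t=ne^t,\quad \beta_t=\tfrac{(e-1)\beta}{e}e^{-t},\quad B_t=\frac{\tau^4N_t^{2-2p}}{8\cdot 9984^2\,\ln\!\big(\frac{1664\ln(208/\tau)}{\tau\beta_t}\big)},\quad M_t=\tfrac{\beta_t}{4}\exp(2N_t^p),\quad \zeta=\tfrac{3\tau}{4},\quad \sigma_t=\frac{\tau}{48\ln(4M_t/\beta_t)}.$$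 EverlastingTO$(\tau,\beta,p)$ works in rounds $t=0,1,2,\dots$. In round $t$ it draws fresh independent datasets $S_t,T_t$ of $\lceil N_t\rceil$ i.i.d. points from $D$ and runs one instance of Thresholdout: it samples $\rho\sim\mathrm{Lap}(2\sigma_t)$ and sets $b=B_t$. As long as $b\ge 1$ and one more query does not bring the number of queries of the round above $M_t$, it accepts a query $q$ and samples $\lambda\sim\mathrm{Lap}(4\sigma_t)$. If $|\mathcal E_{S_t}[q]-\mathcal E_{T_t}[q]|>\zeta+\rho+\lambda$, it answers $a=\mathcal E_{T_t}[q]+\xi$ with $\xi\sim\mathrm{Lap}(\sigma_t)$, resamples $\rho\sim\mathrm{Lap}(2\sigma_t)$, decreases $b$ by $1$ and charges $2N_{t+1}/B_t$; if not, it answers $a=\mathcal E_{S_t}[q]$ and charges $2N_{t+1}/M_t$. As soon as one of the two conditions ($b\ge1$, at most $M_t$ queries) fails, the round ends and the next one begins. All noises are independent, and $\mathrm{Lap}(s)$ has density $\frac1{2s}e^{-|x|/s}$. **Theorem (Validity of EverlastingTO).** For all $\tau,\beta,p\in(0,1)$ there is $n_0=n_0(\tau,\beta,p)>0$ such that for every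 $n\ge n_0$, every sample space $X$, every distribution $D$ on it, every class of queries and every sequence of querying rules as above, the answers $a_0,a_1,\dots$ of EverlastingTO to the queries $q_0,q_1,\dots$ satisfy $$\Pr\big[\exists i:\ |a_i-\mathbb E[q_i]|>\tau\big]<\beta ,$$ where the probability is over the datasets, the noises of the mechanism and the seed of the querying rules. -/

import Mathlib

open MeasureTheory

noncomputable section

namespace EverlastingTO

/-- The law of a standard Laplace variable, with density `exp (-|x|) / 2`. If `z` has this law and
`b > 0`, then `b * z` is a `Lap(b)` variable, of density `exp (-|x| / b) / (2 * b)`. -/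
def laplace : Measure ℝ :=
  volume.withDensity fun x => ENNReal.ofReal (Real.exp (-|x|) / 2)

instance : IsProbabilityMeasure laplace := by
  have hI : IntegrableOn (fun x : ℝ => Real.exp (-x)) (Set.Ioi 0) := integrableOn_exp_neg_Ioi 0
  have hint : Integrable (fun x : ℝ => Real.exp (-|x|) / 2) := by
    apply Integrable.div_const
    have h1 : IntegrableOn (fun x : ℝ => Real.exp (-|x|)) (Set.Ioi 0) :=
      hI.congr_fun (fun x hx => by rw [abs_of_pos (Set.mem_Ioi.1 hx)]) measurableSet_Ioi
    have h2 : IntegrableOn (fun x : ℝ => Real.exp (-|x|)) (Set.Iic 0) := by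
      have h3 : IntegrableOn (fun x : ℝ => Real.exp x) (Set.Iic 0) := integrableOn_exp_Iic 0
      exact h3.congr_fun (fun x hx => by simp [abs_of_nonpos (Set.mem_Iic.1 hx)])
        measurableSet_Iic
    rw [← integrableOn_univ, ← Set.Iic_union_Ioi (a := (0 : ℝ))]
    exact h2.union h1
  constructor
  rw [laplace, withDensity_apply _ MeasurableSet.univ, Measure.restrict_univ,
    ← ofReal_integral_eq_lintegral_ofReal hint (Filter.Eventually.of_forall fun x => by positivity),
    integral_div, integral_comp_abs (f := fun x => Real.exp (-x)), integral_exp_neg_Ioi_zero]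
  norm_num

/-! ### Thresholdout -/

/-- The empirical mean of `f` on the sample consisting of the first `N` points of `s`. -/
def empMean {X : Type*} (N : ℕ) (s : ℕ → X) (f : X → ℝ) : ℝ :=
  (∑ j ∈ Finset.range N, f (s j)) / N

/-- Thresholdout's reaction to one query whose empirical means on the two datasets are `eS` and
`eT`, with current threshold noise `ρ`, query noise `lam` and answer noise `ξ`: the answer,
and the flag `o` (`true` for `⊤`, "the query overfits", and `false` for `⊥`). -/
def thresholdoutReply (ζ eS eT ρ lam ξ : ℝ) : ℝ × Bool :=
  open Classical in
  if |eS - eT| > ζ + ρ + lam then (eT + ξ, true) else (eS, false)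

/-! ### The parameters of EverlastingTO -/

/-- The inputs: accuracy `τ`, failure probability `β`, tradeoff `p`, initial budget `n`. -/
structure Params where
  τ : ℝ
  β : ℝ
  p : ℝ
  n : ℝ

namespace Params

variable (P : Params)

/-- `N_t = n e^t`. -/
def N (t : ℕ) : ℝ := P.n * Real.exp t

/-- The number of points in each of `S_t` and `T_t`: `N_t` rounded up to an integer. -/
def size (t : ℕ) : ℕ := ⌈P.N t⌉₊

/-- `β_t = ((e - 1) β / e) e^{-t}`. -/
def failProb (t : ℕ) : ℝ :=
  (Real.exp 1 - 1) * P.β / Real.exp 1 * Real.exp (-(t : ℝ))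

/-- The overfitting budget
`B_t = τ⁴ N_t^{2 - 2p} / (8 · 9984² · ln (1664 ln (208 / τ) / (τ β_t)))`. -/
def B (t : ℕ) : ℝ :=
  P.τ ^ 4 * P.N t ^ (2 - 2 * P.p) /
    (8 * 9984 ^ 2 * Real.log (1664 * Real.log (208 / P.τ) / (P.τ * P.failProb t)))

/-- The maximal number of queries in round `t`, `M_t = (β_t / 4) exp (2 N_t^p)`. -/
def M (t : ℕ) : ℝ := P.failProb t / 4 * Real.exp (2 * P.N t ^ P.p)

/-- Thresholdout's threshold `ζ = 3 τ / 4`. -/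
def ζ : ℝ := 3 * P.τ / 4

/-- Thresholdout's noise scale in round `t`, `σ_t = τ / (48 ln (4 M_t / β_t))`. -/
def σ (t : ℕ) : ℝ := P.τ / (48 * Real.log (4 * P.M t / P.failProb t))

end Params

/-! ### The randomness of the mechanism -/

/-- What is drawn for one round: the points of `S_t`, the points of `T_t`, and the standard Laplace
variables behind the noises `ρ`, `λ`, `ξ`. Every sequence is infinite; a round uses as
many entries as it needs, each noise entry at most once. -/
abbrev RoundTape (X : Type*) : Type _ :=
  (ℕ → X) × (ℕ → X) × (ℕ → ℝ) × (ℕ → ℝ) × (ℕ → ℝ)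

namespace RoundTape

variable {X : Type*} (r : RoundTape X)

def S : ℕ → X := r.1
def T : ℕ → X := r.2.1
def rho : ℕ → ℝ := r.2.2.1
def lam : ℕ → ℝ := r.2.2.2.1
def xi : ℕ → ℝ := r.2.2.2.2

end RoundTape

/-- The law of one round's tape: sample points i.i.d. from `D`, noises i.i.d. standard Laplace,
everything independent. -/
def roundLaw {X : Type*} [MeasurableSpace X] (D : Measure X) : Measure (RoundTape X) :=
  (Measure.infinitePi fun _ : ℕ => D).prod
    ((Measure.infinitePi fun _ : ℕ => D).prod
      ((Measure.infinitePi fun _ : ℕ => laplace).prod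
        ((Measure.infinitePi fun _ : ℕ => laplace).prod
          (Measure.infinitePi fun _ : ℕ => laplace))))

/-- The law of all the randomness of an interaction: the seed `u` of the querying rules, of law `ν`,
and, independently, one independent tape for every round. -/
def interactionLaw {X U : Type*} [MeasurableSpace X] [MeasurableSpace U] (D : Measure X)
    (ν : Measure U) : Measure (U × (ℕ → RoundTape X)) :=
  ν.prod (Measure.infinitePi fun _ : ℕ => roundLaw D)

/-! ### The interaction -/

/-- An entry of the public history: query, answer, price. Queries are named by elements of `Θ`. -/
abbrev Record (Θ : Type*) : Type _ := Θ × ℝ × ℝ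

/-- Where the mechanism stands: the round `t`, the number of queries answered in this round, and
how many of these received `⊤`. -/
structure RoundState where
  t : ℕ
  answered : ℕ
  overfit : ℕ

/-- The instance of Thresholdout has halted: less than `1` is left of its overfitting budget, or one
more query would exceed `M_t`. -/
def Halted (P : Params) (s : RoundState) : Prop :=
  P.B s.t - s.overfit < 1 ∨ P.M s.t < s.answered + 1

/-- The start of the first round from `t` on whose instance of Thresholdout does not halt before
its first query. (Such a round exists when `τ, β, p ∈ (0, 1)` and `n > 0`, as `B_t, M_t → ∞`.) -/
def startRound (P : Params) (t : ℕ) : RoundState :=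
  ⟨sInf {s : ℕ | t ≤ s ∧ ¬ Halted P ⟨s, 0, 0⟩}, 0, 0⟩

/-- Move on to a new round if the current instance of Thresholdout has halted. -/
def settle (P : Params) (s : RoundState) : RoundState :=
  open Classical in
  if Halted P s then startRound P (s.t + 1) else s

section Interaction

variable {X Θ : Type*}

/-- The reply to the query `f` in state `s`. The threshold noise is `ρ ∼ Lap(2σ)`, drawn afresh
at the start of a round and after every `⊤`; `λ ∼ Lap(4σ)` and `ξ ∼ Lap(σ)` are fresh. -/
def reply (P : Params) (tape : ℕ → RoundTape X) (s : RoundState) (f : X → ℝ) : ℝ × Bool :=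
  thresholdoutReply P.ζ
    (empMean (P.size s.t) (tape s.t).S f)
    (empMean (P.size s.t) (tape s.t).T f)
    (2 * P.σ s.t * (tape s.t).rho s.overfit)
    (4 * P.σ s.t * (tape s.t).lam s.answered)
    (P.σ s.t * (tape s.t).xi s.answered)

/-- The charge in round `t`: `2 N_{t+1} / B_t` for `o = ⊤`, and `2 N_{t+1} / M_t` for `o = ⊥`. -/
def price (P : Params) (t : ℕ) (o : Bool) : ℝ :=
  if o then 2 * P.N (t + 1) / P.B t else 2 * P.N (t + 1) / P.M t

/-- The state after a query of state `s` was answered with flag `o`. -/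
def nextState (P : Params) (s : RoundState) (o : Bool) : RoundState :=
  settle P ⟨s.t, s.answered + 1, if o then s.overfit + 1 else s.overfit⟩

/-- One query: the history and the state after `θ` (which names the query `q θ`) was posed. -/
def answerQuery (P : Params) (q : Θ → X → ℝ) (tape : ℕ → RoundTape X) {i : ℕ} (θ : Θ)
    (h : Fin i → Record Θ) (s : RoundState) : (Fin (i + 1) → Record Θ) × RoundState :=
  (Fin.snoc (α := fun _ => Record Θ) h
      (θ, (reply P tape s (q θ)).1, price P s.t (reply P tape s (q θ)).2),
    nextState P s (reply P tape s (q θ)).2)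

/-- The history of the first `i` queries, and the state after them, in the interaction of
EverlastingTO with the querying rules `R` (evaluated at their random seed). -/
def run (P : Params) (q : Θ → X → ℝ) (R : ∀ i : ℕ, (Fin i → Record Θ) → Θ)
    (tape : ℕ → RoundTape X) : (i : ℕ) → (Fin i → Record Θ) × RoundState
  | 0 => (Fin.elim0, startRound P 0)
  | i + 1 => answerQuery P q tape (R i (run P q R tape i).1) (run P q R tape i).1
      (run P q R tape i).2

/-- The record of query number `i` (counted from `0`). -/
def record (P : Params) (q : Θ → X → ℝ) (R : ∀ i : ℕ, (Fin i → Record Θ) → Θ)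
    (tape : ℕ → RoundTape X) (i : ℕ) : Record Θ :=
  (run P q R tape (i + 1)).1 (Fin.last i)

/-- The `i`-th query posed, as a function on the sample space. -/
def query (P : Params) (q : Θ → X → ℝ) (R : ∀ i : ℕ, (Fin i → Record Θ) → Θ)
    (tape : ℕ → RoundTape X) (i : ℕ) : X → ℝ :=
  q (record P q R tape i).1

/-- The answer to the `i`-th query. -/
def answer (P : Params) (q : Θ → X → ℝ) (R : ∀ i : ℕ, (Fin i → Record Θ) → Θ)
    (tape : ℕ → RoundTape X) (i : ℕ) : ℝ :=
  (record P q R tape i).2.1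

end Interaction

end EverlastingTO

end

noncomputable section

namespace EverlastingTO

open Set

/-! ### Resampling one coordinate of a product measure -/

/-! Fix a round `t` and freeze the seed, the tapes of all other rounds and the dataset `S` of round
`t`. What remains random is the dataset `T` and the noises of that round. The transcript sees `T`
only through noisy threshold tests and through the noisy answers released at the at most ⌊B_t⌋
successes. It is therefore a differentially private function of `T`, and differential privacy forces
generalization.

Privacy. Cut the round into epochs, each ending with a success. Raising the threshold noise absorbs
the change of one data point in all failed tests at once, so an epoch is 2Δ/σ-private however long
it is (`epochLaw_le`). For two laws with likelihood ratio in [e^{-ε}, e^ε], Hölder's inequality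
costs a factor whose logarithm is quadratic in ε (`lintegral_le_of_bounded_ratio`). It iterates over
the epochs (`value_le_rpow`), and Young's inequality turns the result into an (ε, δ) bound
(`value_le_exp_mul_add`). `play_take` identifies the actual interaction with the abstract game.

Generalization. Unless some noise is large, every answer is within 15τ/16 of the mean over `T`, so
an answer off by more than τ exhibits a query (or complement of one) whose mean over `T` exceeds its
true mean by τ/16. Let x be the probability of such an answer in the round and W the expected value
of the exhibited query at a fresh point. By privacy its expected value at a sample point is at most
e^ε W + δ, since a sample point and a fresh point are exchangeable. Hence τx/16 + W ≤ e^ε W + δ +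
2η, where η is the probability of a large noise. As W ≤ x, the choice ε = τ/52 gives x ≤ β_t/2
(`measure_bad_round_le`, `le_half_of_stability`).

The bound is uniform in everything frozen, so it survives averaging (`interactionLaw_bad_le`), and
summing over `t` gives β/2 < β. -/

theorem infinitePi_map_update {ι : Type*} [DecidableEq ι] {X : ι → Type*}
    [∀ i, MeasurableSpace (X i)] (μ : ∀ i, Measure (X i)) [∀ i, IsProbabilityMeasure (μ i)]
    (i : ι) :
    ((Measure.infinitePi μ).prod (μ i)).map (fun p => Function.update p.1 i p.2) =
      Measure.infinitePi μ := by
  refine Measure.eq_infinitePi μ fun s t ht => ?_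
  rw [Measure.map_apply measurable_update' (.pi s.countable_toSet fun _ _ => ht _)]
  by_cases hi : i ∈ s
  · have : (fun p : (∀ i, X i) × X i => Function.update p.1 i p.2) ⁻¹' ((s : Set ι).pi t) =
        (((s.erase i : Finset ι) : Set ι).pi t) ×ˢ t i := by
      ext ⟨x, z⟩
      simp only [mem_preimage, Set.mem_pi, mem_prod, Finset.mem_coe, Finset.mem_erase]
      constructor
      · intro h
        refine ⟨fun j hj => ?_, ?_⟩
        · simpa [Function.update_of_ne hj.1] using h j hj.2
        · simpa using h i hi
      · rintro ⟨h1, h2⟩ j hj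
        by_cases hji : j = i
        · subst hji; simpa using h2
        · simpa [Function.update_of_ne hji] using h1 j ⟨hji, hj⟩
    rw [this, Measure.prod_prod, Measure.infinitePi_pi μ (fun j _ => ht j),
      Finset.prod_erase_mul _ _ hi]
  · have : (fun p : (∀ i, X i) × X i => Function.update p.1 i p.2) ⁻¹' ((s : Set ι).pi t) =
        ((s : Set ι).pi t) ×ˢ univ := by
      ext ⟨x, z⟩
      simp only [mem_preimage, Set.mem_pi, mem_prod, Finset.mem_coe, mem_univ, and_true]
      refine forall₂_congr fun j hj => ?_
      have hji : j ≠ i := fun h => hi (h ▸ hj)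
      rw [Function.update_of_ne hji]
    rw [this, Measure.prod_prod, Measure.infinitePi_pi μ (fun j _ => ht j), measure_univ, mul_one]

/-- Independence in the form used throughout: a single coordinate (a noise, a data point, the tape
of a round) is integrated out while all others stay frozen. -/
theorem lintegral_infinitePi_update {ι : Type*} [DecidableEq ι] {X : ι → Type*}
    [∀ i, MeasurableSpace (X i)] (μ : ∀ i, Measure (X i)) [∀ i, IsProbabilityMeasure (μ i)]
    (i : ι) {F : (∀ i, X i) → ENNReal} (hF : Measurable F) :
    ∫⁻ x, F x ∂Measure.infinitePi μ =
      ∫⁻ x, ∫⁻ z, F (Function.update x i z) ∂μ i ∂Measure.infinitePi μ := by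
  conv_lhs => rw [← infinitePi_map_update μ i]
  rw [lintegral_map hF measurable_update', lintegral_prod]
  exact (hF.comp measurable_update').aemeasurable

/-- After coordinate `j` is resampled, both sides are integrals over two independent points of law
`D`, with the two names exchanged. -/
theorem lintegral_infinitePi_swap {X : Type*} [MeasurableSpace X] (D : Measure X)
    [IsProbabilityMeasure D] (j : ℕ) {F : (ℕ → X) → X → ENNReal}
    (hF : Measurable (Function.uncurry F)) :
    ∫⁻ T, ∫⁻ x, F (Function.update T j x) (T j) ∂D ∂Measure.infinitePi (fun _ : ℕ => D) =
      ∫⁻ T, ∫⁻ x, F T x ∂D ∂Measure.infinitePi (fun _ : ℕ => D) := by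
  have hG : Measurable fun T : ℕ → X => ∫⁻ x, F (Function.update T j x) (T j) ∂D := by
    refine Measurable.lintegral_prod_right' (f := fun p : (ℕ → X) × X =>
      F (Function.update p.1 j p.2) (p.1 j)) ?_
    exact hF.comp ((measurable_update' (a := j)).prodMk
      ((measurable_pi_apply j).comp measurable_fst))
  have hG' : Measurable fun T : ℕ → X => ∫⁻ x, F T x ∂D :=
    Measurable.lintegral_prod_right' (f := fun p : (ℕ → X) × X => F p.1 p.2) hF
  rw [lintegral_infinitePi_update (fun _ : ℕ => D) j hG,
    lintegral_infinitePi_update (fun _ : ℕ => D) j hG']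
  refine lintegral_congr fun T => ?_
  simp only [Function.update_idem, Function.update_self]
  rw [lintegral_lintegral_swap]
  refine (hF.comp (((measurable_update' (a := j)).comp
    (measurable_const.prodMk measurable_snd)).prodMk measurable_fst)).aemeasurable

/-! ### The Laplace law -/

theorem lintegral_laplace {g : ℝ → ENNReal} (hg : Measurable g) :
    ∫⁻ x, g x ∂laplace = ∫⁻ x, ENNReal.ofReal (Real.exp (-|x|) / 2) * g x := by
  rw [laplace, lintegral_withDensity_eq_lintegral_mul _ (by fun_prop) hg]
  rfl

/-- Shifting a standard Laplace variable by `a` costs at most the factor `exp |a|`. -/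
theorem lintegral_laplace_add_le {g : ℝ → ENNReal} (hg : Measurable g) (a : ℝ) :
    ∫⁻ x, g (x + a) ∂laplace ≤ ENNReal.ofReal (Real.exp |a|) * ∫⁻ x, g x ∂laplace := by
  rw [lintegral_laplace (by fun_prop), lintegral_laplace hg,
    ← lintegral_const_mul _ (by fun_prop),
    ← lintegral_add_right_eq_self
      (fun x => ENNReal.ofReal (Real.exp |a|) * (ENNReal.ofReal (Real.exp (-|x|) / 2) * g x)) a]
  refine lintegral_mono fun x => ?_
  simp only
  rw [← mul_assoc, ← ENNReal.ofReal_mul (Real.exp_pos _).le, ← mul_div_assoc, ← Real.exp_add]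
  gcongr
  have := abs_add_le x a
  linarith

theorem laplace_Iio_add_le (x : ℝ) {a : ℝ} (ha : 0 ≤ a) :
    laplace (Iio (x + a)) ≤ ENNReal.ofReal (Real.exp a) * laplace (Iio x) := by
  have h := lintegral_laplace_add_le
    (g := (Iio x).indicator 1) (measurable_one.indicator measurableSet_Iio) (-a)
  rw [lintegral_indicator_one measurableSet_Iio, abs_neg, abs_of_nonneg ha] at h
  refine le_trans (le_of_eq ?_) h
  rw [← lintegral_indicator_one measurableSet_Iio]
  refine lintegral_congr fun y => ?_
  simp only [indicator, mem_Iio]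
  congr 1
  simp only [eq_iff_iff]
  constructor <;> intro <;> linarith

theorem laplace_Ioi {x : ℝ} (hx : 0 ≤ x) :
    laplace (Ioi x) = ENNReal.ofReal (Real.exp (-x) / 2) := by
  rw [laplace, withDensity_apply _ measurableSet_Ioi]
  have h1 : IntegrableOn (fun y : ℝ => Real.exp (-y) / 2) (Ioi x) :=
    (integrableOn_exp_neg_Ioi x).div_const 2
  rw [← integral_exp_neg_Ioi x, ← integral_div,
    ofReal_integral_eq_lintegral_ofReal h1 (Filter.Eventually.of_forall fun y => by positivity)]
  refine setLIntegral_congr_fun measurableSet_Ioi fun y hy => ?_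
  rw [abs_of_pos (lt_of_le_of_lt hx hy)]

theorem laplace_neg_preimage {s : Set ℝ} (hs : MeasurableSet s) :
    laplace (Neg.neg ⁻¹' s) = laplace s := by
  rw [← lintegral_indicator_one hs, ← lintegral_indicator_one (hs.preimage measurable_neg),
    lintegral_laplace (measurable_one.indicator hs),
    lintegral_laplace (measurable_one.indicator (hs.preimage measurable_neg)),
    ← lintegral_neg_eq_self]
  refine lintegral_congr fun x => ?_
  have h : -x ∈ Neg.neg ⁻¹' s ↔ x ∈ s := by rw [mem_preimage, neg_neg]
  rw [abs_neg]
  by_cases hx : x ∈ s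
  · rw [indicator_of_mem hx, indicator_of_mem (h.2 hx)]
    rfl
  · rw [indicator_of_notMem hx, indicator_of_notMem (h.not.2 hx)]

theorem laplace_abs_gt {x : ℝ} (hx : 0 ≤ x) :
    laplace {z | x < |z|} ≤ ENNReal.ofReal (Real.exp (-x)) := by
  have : {z : ℝ | x < |z|} ⊆ Ioi x ∪ Neg.neg ⁻¹' Ioi x := by
    intro z hz
    rcases lt_abs.1 (show x < |z| from hz) with h | h
    · exact Or.inl h
    · exact Or.inr h
  refine (measure_mono this).trans ((measure_union_le _ _).trans ?_)
  rw [laplace_neg_preimage measurableSet_Ioi, laplace_Ioi hx,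
    ← ENNReal.ofReal_add (by positivity) (by positivity)]
  exact ENNReal.ofReal_le_ofReal (by linarith)

/-! ### Hölder's inequality for measures with bounded likelihood ratio -/

/-- Convexity of r ↦ r^α. The bound is affine in `r`, so its integral depends only on the mean of
`r`, which is 1 for a likelihood ratio. -/
theorem rpow_le_chord {ε α r : ℝ} (hε : 0 < ε) (hα : 1 ≤ α) (h1 : Real.exp (-ε) ≤ r)
    (h2 : r ≤ Real.exp ε) :
    r ^ α ≤ ((Real.exp ε - r) * Real.exp (-ε * α) + (r - Real.exp (-ε)) * Real.exp (ε * α)) /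
      (Real.exp ε - Real.exp (-ε)) := by
  have hd : 0 < Real.exp ε - Real.exp (-ε) := sub_pos.2 (Real.exp_lt_exp.2 (by linarith))
  have h := (convexOn_rpow hα).2 (mem_Ici.2 (Real.exp_pos (-ε)).le)
    (mem_Ici.2 (Real.exp_pos ε).le)
    (show 0 ≤ (Real.exp ε - r) / (Real.exp ε - Real.exp (-ε)) from
      div_nonneg (by linarith) hd.le)
    (show 0 ≤ (r - Real.exp (-ε)) / (Real.exp ε - Real.exp (-ε)) from
      div_nonneg (by linarith) hd.le)
    (by rw [← add_div, div_eq_one_iff_eq hd.ne']; ring)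
  simp only [smul_eq_mul, ← Real.exp_mul] at h
  refine le_trans (le_of_eq ?_) (h.trans (le_of_eq ?_))
  · congr 1
    field_simp
    ring
  · field_simp

/-- The chord at 1 lies below cosh((α - 1/2)ε); in terms of a = e^{ε/2} the gap factors with visibly
nonnegative terms. -/
theorem chord_at_one_le {ε α : ℝ} (hε : 0 < ε) :
    ((Real.exp ε - 1) * Real.exp (-ε * α) + (1 - Real.exp (-ε)) * Real.exp (ε * α)) /
      (Real.exp ε - Real.exp (-ε)) ≤ Real.exp ((α - 1 / 2) ^ 2 * ε ^ 2 / 2) := by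
  have hd : 0 < Real.exp ε - Real.exp (-ε) := sub_pos.2 (Real.exp_lt_exp.2 (by linarith))
  have hcosh := Real.cosh_le_exp_half_sq ((α - 1 / 2) * ε)
  rw [mul_pow] at hcosh
  refine le_trans ?_ hcosh
  rw [div_le_iff₀ hd, Real.cosh_eq]
  set a := Real.exp (ε / 2) with ha
  set b := Real.exp ((α - 1 / 2) * ε) with hb
  have ha1 : 1 < a := Real.one_lt_exp_iff.2 (by linarith)
  have hb0 : 0 < b := Real.exp_pos _
  have e1 : Real.exp ε = a ^ 2 := by rw [ha, ← Real.exp_nat_mul]; congr 1; push_cast; ring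
  have e2 : Real.exp (-ε) = (a ^ 2)⁻¹ := by rw [Real.exp_neg, e1]
  have e3 : Real.exp (ε * α) = b * a := by rw [ha, hb, ← Real.exp_add]; congr 1; ring
  have e4 : Real.exp (-ε * α) = (b * a)⁻¹ := by rw [neg_mul, Real.exp_neg, e3]
  have e5 : Real.exp (-((α - 1 / 2) * ε)) = b⁻¹ := by rw [Real.exp_neg]
  rw [e1, e2, e3, e4, e5]
  have ha0 : 0 < a := by linarith
  have key : (b + b⁻¹) / 2 * (a ^ 2 - (a ^ 2)⁻¹) -
      ((a ^ 2 - 1) * (b * a)⁻¹ + (1 - (a ^ 2)⁻¹) * (b * a)) =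
      (b + b⁻¹) * (a ^ 2 - 1) * (a - 1) ^ 2 / (2 * a ^ 2) := by
    field_simp
    ring
  have : 0 ≤ (b + b⁻¹) * (a ^ 2 - 1) * (a - 1) ^ 2 / (2 * a ^ 2) := by
    have : 0 ≤ a ^ 2 - 1 := by nlinarith
    positivity
  linarith

/-- Hölder separates `φ` from the density dA/dB, which lies in [e^{-ε}, e^ε] almost everywhere and
has mean 1; the chord bound controls its `α`-th moment. The exponent is quadratic in `ε`, which
keeps the loss over many compositions small. -/
theorem lintegral_le_of_bounded_ratio {Ω : Type*} [MeasurableSpace Ω] {A B : Measure Ω}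
    [IsProbabilityMeasure A] [IsProbabilityMeasure B] {ε : ℝ} (hε : 0 < ε)
    (hAB : A ≤ ENNReal.ofReal (Real.exp ε) • B) (hBA : B ≤ ENNReal.ofReal (Real.exp ε) • A)
    {α s : ℝ} (hαs : α.HolderConjugate s) {φ : Ω → ENNReal} (hφ : Measurable φ) :
    ∫⁻ ω, φ ω ∂A ≤ ENNReal.ofReal (Real.exp ((α - 1 / 2) ^ 2 * ε ^ 2 / 2)) ^ (1 / α) *
      (∫⁻ ω, φ ω ^ s ∂B) ^ (1 / s) := by
  have hac : A ≪ B := (Measure.absolutelyContinuous_of_le hAB).trans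
    Measure.smul_absolutelyContinuous
  set x := A.rnDeriv B with hx
  have hxm : Measurable x := Measure.measurable_rnDeriv A B
  have hset : ∀ t, ∫⁻ ω in t, x ω ∂B = A t := fun t => Measure.setLIntegral_rnDeriv hac t
  have hup : ∀ᵐ ω ∂B, x ω ≤ ENNReal.ofReal (Real.exp ε) := by
    refine ae_le_of_forall_setLIntegral_le_of_sigmaFinite hxm fun t _ _ => ?_
    rw [hset, setLIntegral_const]
    exact hAB t
  have hlow : ∀ᵐ ω ∂B, ENNReal.ofReal (Real.exp (-ε)) ≤ x ω := by
    refine ae_le_of_forall_setLIntegral_le_of_sigmaFinite measurable_const fun t _ _ => ?_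
    rw [hset, setLIntegral_const]
    calc ENNReal.ofReal (Real.exp (-ε)) * B t
        ≤ ENNReal.ofReal (Real.exp (-ε)) * (ENNReal.ofReal (Real.exp ε) * A t) := by
          gcongr; exact hBA t
      _ = A t := by
          rw [← mul_assoc, ← ENNReal.ofReal_mul (Real.exp_pos _).le, ← Real.exp_add]
          simp
  have h1 : ∫⁻ ω, φ ω ∂A = ∫⁻ ω, x ω * φ ω ∂B := by
    conv_lhs => rw [← Measure.withDensity_rnDeriv_eq A B hac]
    rw [lintegral_withDensity_eq_lintegral_mul _ hxm hφ]
    rfl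
  have hr1 : ∫ ω, (x ω).toReal ∂B = 1 := by
    rw [hx, Measure.integral_toReal_rnDeriv hac]
    simp
  have hrint : Integrable (fun ω => (x ω).toReal) B := Measure.integrable_toReal_rnDeriv
  have hpow : ∫⁻ ω, x ω ^ α ∂B ≤ ENNReal.ofReal (Real.exp ((α - 1 / 2) ^ 2 * ε ^ 2 / 2)) := by
    have hi1 : Integrable (fun ω => (Real.exp ε - (x ω).toReal) * Real.exp (-ε * α)) B :=
      ((integrable_const _).sub hrint).mul_const _
    have hi2 : Integrable (fun ω => ((x ω).toReal - Real.exp (-ε)) * Real.exp (ε * α)) B :=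
      (hrint.sub (integrable_const _)).mul_const _
    have hint : Integrable (fun ω => ((Real.exp ε - (x ω).toReal) * Real.exp (-ε * α) +
        ((x ω).toReal - Real.exp (-ε)) * Real.exp (ε * α)) /
          (Real.exp ε - Real.exp (-ε))) B :=
      (hi1.add hi2).div_const _
    have hle : ∀ᵐ ω ∂B, x ω ^ α ≤ ENNReal.ofReal (((Real.exp ε - (x ω).toReal) *
        Real.exp (-ε * α) + ((x ω).toReal - Real.exp (-ε)) * Real.exp (ε * α)) /
          (Real.exp ε - Real.exp (-ε))) := by
      filter_upwards [hup, hlow] with ω h1 h2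
      have hfin : x ω ≠ ⊤ := ne_top_of_le_ne_top ENNReal.ofReal_ne_top h1
      have h1' : (x ω).toReal ≤ Real.exp ε := ENNReal.toReal_le_of_le_ofReal (Real.exp_pos _).le h1
      have h2' : Real.exp (-ε) ≤ (x ω).toReal := (ENNReal.ofReal_le_iff_le_toReal hfin).1 h2
      rw [← ENNReal.ofReal_toReal hfin, ENNReal.ofReal_rpow_of_nonneg ENNReal.toReal_nonneg
        hαs.nonneg, ENNReal.toReal_ofReal ENNReal.toReal_nonneg]
      exact ENNReal.ofReal_le_ofReal (rpow_le_chord hε hαs.lt.le h2' h1')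
    have hnn : 0 ≤ᵐ[B] fun ω => ((Real.exp ε - (x ω).toReal) *
        Real.exp (-ε * α) + ((x ω).toReal - Real.exp (-ε)) * Real.exp (ε * α)) /
          (Real.exp ε - Real.exp (-ε)) := by
      filter_upwards [hup, hlow] with ω h1 h2
      have hfin : x ω ≠ ⊤ := ne_top_of_le_ne_top ENNReal.ofReal_ne_top h1
      have h1' : (x ω).toReal ≤ Real.exp ε := ENNReal.toReal_le_of_le_ofReal (Real.exp_pos _).le h1
      have h2' : Real.exp (-ε) ≤ (x ω).toReal := (ENNReal.ofReal_le_iff_le_toReal hfin).1 h2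
      exact le_trans (Real.rpow_nonneg ENNReal.toReal_nonneg α) (rpow_le_chord hε hαs.lt.le h2' h1')
    refine (lintegral_mono_ae hle).trans ?_
    rw [← ofReal_integral_eq_lintegral_ofReal hint hnn]
    refine ENNReal.ofReal_le_ofReal (le_trans (le_of_eq ?_) (chord_at_one_le hε))
    rw [integral_div, integral_add hi1 hi2, integral_mul_const, integral_mul_const,
      integral_sub (integrable_const _) hrint, integral_sub hrint (integrable_const _), hr1]
    simp
  rw [h1]
  refine (ENNReal.lintegral_mul_le_Lp_mul_Lq B hαs hxm.aemeasurable hφ.aemeasurable).trans ?_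
  gcongr
  exact one_div_nonneg.2 hαs.nonneg

/-! ### The sparse vector game -/

/-- The rules of a sparse vector game, apart from the statistics of the sensitive dataset. In an
active state a noisy threshold test is made: the next state is `bot z` if it fails, and `top (z, a)`
with a noisy answer `a` if it succeeds. -/
structure SparseGame (Z : Type*) [MeasurableSpace Z] where
  act : Set Z
  bot : Z → Z
  top : Z × ℝ → Z
  idle : Z → Z
  σ : ℝ
  measurableSet_act : MeasurableSet act
  measurable_bot : Measurable bot
  measurable_top : Measurable top
  measurable_idle : Measurable idle

/-- The statistics of the sensitive dataset: the test statistic and the value to be released. -/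
structure Stat (Z : Type*) [MeasurableSpace Z] where
  c : Z → ℝ
  e : Z → ℝ
  measurable_c : Measurable c
  measurable_e : Measurable e

namespace SparseGame

variable {Z : Type*} [MeasurableSpace Z] (G : SparseGame Z) (s : Stat Z)

open Classical in
/-- The law of the state after the first success within `m` steps from `z`, with the number of
steps left, or of the final state (flag `false`) if there is none; `ρ` is the threshold noise. -/
def epoch : ℕ → Z → ℝ → Measure (Bool × ℕ × Z)
  | 0, z, _ => Measure.dirac (false, 0, z)
  | m + 1, z, ρ =>
    if z ∈ G.act then
      laplace.bind fun lam =>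
        if lam < (s.c z - 2 * G.σ * ρ) / (4 * G.σ) then
          laplace.map fun ξ => (true, m, G.top (z, s.e z + G.σ * ξ))
        else epoch m (G.bot z) ρ
    else epoch m (G.idle z) ρ

theorem measurable_release (m : ℕ) (z : Z) :
    Measurable fun ξ : ℝ => (true, m, G.top (z, s.e z + G.σ * ξ)) :=
  measurable_const.prodMk (measurable_const.prodMk (G.measurable_top.comp
    (measurable_const.prodMk (by fun_prop))))

theorem lintegral_laplace_ite (x : ℝ) (a b : ENNReal) :
    ∫⁻ y, (if y < x then a else b) ∂laplace = laplace (Iio x) * a + laplace (Ici x) * b := by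
  rw [← lintegral_add_compl _ (measurableSet_Iio (a := x)), compl_Iio,
    setLIntegral_congr_fun (g := fun _ => a) measurableSet_Iio
      (fun y hy => by simp only [if_pos (mem_Iio.1 hy)]),
    setLIntegral_congr_fun (g := fun _ => b) measurableSet_Ici
      (fun y hy => by simp only [if_neg (not_lt.2 (mem_Ici.1 hy))]),
    setLIntegral_const, setLIntegral_const, mul_comm, mul_comm (laplace (Ici x))]

open Classical in
theorem lintegral_epoch_succ {Φ : Bool × ℕ × Z → ENNReal} (hΦ : Measurable Φ) (m : ℕ) (z : Z)
    (ρ : ℝ) :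
    ∫⁻ ω, Φ ω ∂G.epoch s (m + 1) z ρ =
      if z ∈ G.act then
        laplace (Iio ((s.c z - 2 * G.σ * ρ) / (4 * G.σ))) *
            (∫⁻ ξ, Φ (true, m, G.top (z, s.e z + G.σ * ξ)) ∂laplace) +
          laplace (Ici ((s.c z - 2 * G.σ * ρ) / (4 * G.σ))) *
            ∫⁻ ω, Φ ω ∂G.epoch s m (G.bot z) ρ
      else ∫⁻ ω, Φ ω ∂G.epoch s m (G.idle z) ρ := by
  rw [epoch]
  split_ifs with hz
  · rw [Measure.lintegral_bind _ hΦ.aemeasurable]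
    · rw [← lintegral_map hΦ (G.measurable_release s m z), ← lintegral_laplace_ite]
      refine lintegral_congr fun y => ?_
      split_ifs <;> rfl
    · exact (Measurable.ite measurableSet_Iio measurable_const measurable_const).aemeasurable
  · rfl

theorem measurable_laplace_Iio : Measurable fun x : ℝ => laplace (Iio x) :=
  Monotone.measurable fun _ _ h => measure_mono (Iio_subset_Iio h)

theorem measurable_laplace_Ici : Measurable fun x : ℝ => laplace (Ici x) :=
  Antitone.measurable fun _ _ h => measure_mono (Ici_subset_Ici.2 h)

theorem measurable_lintegral_epoch {Φ : Bool × ℕ × Z → ENNReal} (hΦ : Measurable Φ) (m : ℕ) :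
    Measurable fun p : Z × ℝ => ∫⁻ ω, Φ ω ∂G.epoch s m p.1 p.2 := by
  classical
  induction m with
  | zero =>
    simp only [epoch, lintegral_dirac' _ hΦ]
    exact hΦ.comp (measurable_const.prodMk (measurable_const.prodMk measurable_fst))
  | succ m ih =>
    simp only [G.lintegral_epoch_succ s hΦ]
    have hx : Measurable fun p : Z × ℝ => (s.c p.1 - 2 * G.σ * p.2) / (4 * G.σ) :=
      ((s.measurable_c.comp measurable_fst).sub (measurable_snd.const_mul _)).div_const _
    refine Measurable.ite (measurable_fst G.measurableSet_act) ?_ ?_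
    · refine ((measurable_laplace_Iio.comp hx).mul ?_).add ((measurable_laplace_Ici.comp hx).mul ?_)
      · refine Measurable.lintegral_prod_right' (f := fun q : (Z × ℝ) × ℝ =>
          Φ (true, m, G.top (q.1.1, s.e q.1.1 + G.σ * q.2))) (hΦ.comp ?_)
        refine measurable_const.prodMk (measurable_const.prodMk (G.measurable_top.comp ?_))
        exact (measurable_fst.comp measurable_fst).prodMk
          ((s.measurable_e.comp (measurable_fst.comp measurable_fst)).add
            (measurable_snd.const_mul _))
      · exact ih.comp ((G.measurable_bot.comp measurable_fst).prodMk measurable_snd)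
    · exact ih.comp ((G.measurable_idle.comp measurable_fst).prodMk measurable_snd)

theorem measurable_epoch (m : ℕ) (z : Z) : Measurable fun ρ => G.epoch s m z ρ := by
  refine Measure.measurable_of_measurable_coe _ fun t ht => ?_
  simp only [← lintegral_indicator_one ht]
  exact (G.measurable_lintegral_epoch s (measurable_one.indicator ht) m).comp
    (measurable_const.prodMk measurable_id)

theorem lintegral_epoch_one (m : ℕ) (z : Z) (ρ : ℝ) :
    ∫⁻ _, 1 ∂G.epoch s m z ρ = 1 := by
  classical
  induction m generalizing z with
  | zero => simp [epoch]
  | succ m ih =>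
    rw [G.lintegral_epoch_succ s measurable_const]
    split_ifs
    · rw [ih, lintegral_one, measure_univ, mul_one, mul_one, ← compl_Iio,
        prob_add_prob_compl measurableSet_Iio]
    · exact ih _

/-- The law of an epoch with fresh threshold noise. -/
def epochLaw (m : ℕ) (z : Z) : Measure (Bool × ℕ × Z) :=
  laplace.bind fun ρ => G.epoch s m z ρ

theorem lintegral_epochLaw {Φ : Bool × ℕ × Z → ENNReal} (hΦ : Measurable Φ) (m : ℕ) (z : Z) :
    ∫⁻ ω, Φ ω ∂G.epochLaw s m z = ∫⁻ ρ, ∫⁻ ω, Φ ω ∂G.epoch s m z ρ ∂laplace :=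
  Measure.lintegral_bind (G.measurable_epoch s m z).aemeasurable hΦ.aemeasurable

instance (m : ℕ) (z : Z) : IsProbabilityMeasure (G.epochLaw s m z) := by
  constructor
  rw [← lintegral_one, G.lintegral_epochLaw s measurable_const]
  simp only [lintegral_epoch_one]
  rw [lintegral_one, measure_univ]

theorem measurable_lintegral_epochLaw {Φ : Bool × ℕ × Z → ENNReal} (hΦ : Measurable Φ) (m : ℕ) :
    Measurable fun z => ∫⁻ ω, Φ ω ∂G.epochLaw s m z := by
  simp only [G.lintegral_epochLaw s hΦ]
  exact (G.measurable_lintegral_epoch s hΦ m).lintegral_prod_right'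

/-! ### Differential privacy of a single epoch -/

/-- Statistics which differ by at most `Δ` everywhere, as for two adjacent datasets. -/
def Stat.Close (Δ : ℝ) (s s' : Stat Z) : Prop :=
  ∀ z, |s.c z - s'.c z| ≤ Δ ∧ |s.e z - s'.e z| ≤ Δ

variable {s} {s' : Stat Z} {Δ : ℝ} (hσ : 0 < G.σ) (hs : Stat.Close Δ s s')

theorem Stat.Close.symm (hs : Stat.Close Δ s s') : Stat.Close Δ s' s := fun z =>
  ⟨abs_sub_comm (s.c z) _ ▸ (hs z).1, abs_sub_comm (s.e z) _ ▸ (hs z).2⟩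

include hσ hs

theorem lintegral_release_le {g : Z → ENNReal} (hg : Measurable g) (z : Z) :
    ∫⁻ ξ, g (G.top (z, s.e z + G.σ * ξ)) ∂laplace ≤
      ENNReal.ofReal (Real.exp (Δ / G.σ)) *
        ∫⁻ ξ, g (G.top (z, s'.e z + G.σ * ξ)) ∂laplace := by
  have hm : Measurable fun ξ : ℝ => g (G.top (z, s'.e z + G.σ * ξ)) :=
    hg.comp (G.measurable_top.comp (measurable_const.prodMk (by fun_prop)))
  have h := lintegral_laplace_add_le hm ((s.e z - s'.e z) / G.σ)
  refine (le_of_eq ?_).trans (h.trans ?_)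
  · refine lintegral_congr fun ξ => ?_
    congr 3
    field_simp
    ring
  · gcongr
    rw [abs_div, abs_of_pos hσ]
    gcongr
    exact (hs z).2

/-- Moving `ρ` by Δ/(2σ) raises the threshold by exactly Δ, so every failed test is at least as
likely to fail under `s'`, at no cost. Only the final success is paid for: its comparison moves by
at most 2Δ against noise of scale 4σ, costing Δ/(2σ), and the released value costs Δ/σ. -/
theorem lintegral_epoch_le {Φ : Bool × ℕ × Z → ENNReal} (hΦ : Measurable Φ) (m : ℕ) (z : Z)
    (ρ : ℝ) :
    ∫⁻ ω, Φ ω ∂G.epoch s m z ρ ≤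
      ENNReal.ofReal (Real.exp (Δ / (2 * G.σ) + Δ / G.σ)) *
        ∫⁻ ω, Φ ω ∂G.epoch s' m z (ρ + Δ / (2 * G.σ)) := by
  classical
  have hΔ : 0 ≤ Δ := (abs_nonneg _).trans (hs z).1
  have hE : 1 ≤ ENNReal.ofReal (Real.exp (Δ / (2 * G.σ) + Δ / G.σ)) := by
    rw [ENNReal.one_le_ofReal]
    exact Real.one_le_exp (by positivity)
  induction m generalizing z with
  | zero => exact le_mul_of_one_le_left' hE
  | succ m ih =>
    rw [G.lintegral_epoch_succ s hΦ, G.lintegral_epoch_succ s' hΦ]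
    split_ifs with hz
    · have hc := abs_le.1 (hs z).1
      rw [mul_add]
      refine add_le_add ?_ ?_
      · have h1 : (s.c z - 2 * G.σ * ρ) / (4 * G.σ) ≤
            (s'.c z - 2 * G.σ * (ρ + Δ / (2 * G.σ))) / (4 * G.σ) + Δ / (2 * G.σ) := by
          have : (s'.c z - 2 * G.σ * (ρ + Δ / (2 * G.σ))) / (4 * G.σ) + Δ / (2 * G.σ) =
            (s'.c z + Δ - 2 * G.σ * ρ) / (4 * G.σ) := by
            field_simp
            ring
          rw [this]
          gcongr
          linarith
        have h2 := (measure_mono (Iio_subset_Iio h1)).trans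
          (laplace_Iio_add_le ((s'.c z - 2 * G.σ * (ρ + Δ / (2 * G.σ))) / (4 * G.σ))
            (a := Δ / (2 * G.σ)) (by positivity))
        have h3 := G.lintegral_release_le hσ hs (g := fun w => Φ (true, m, w))
          (hΦ.comp (measurable_const.prodMk (measurable_const.prodMk measurable_id))) z
        refine (mul_le_mul' h2 h3).trans (le_of_eq ?_)
        rw [Real.exp_add, ENNReal.ofReal_mul (Real.exp_pos _).le]
        ring
      -- The raised threshold makes failure under `s'` at least as likely, so this branch
      -- contributes no factor.
      · have h1 : (s'.c z - 2 * G.σ * (ρ + Δ / (2 * G.σ))) / (4 * G.σ) ≤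
            (s.c z - 2 * G.σ * ρ) / (4 * G.σ) := by
          have : 2 * G.σ * (ρ + Δ / (2 * G.σ)) = 2 * G.σ * ρ + Δ := by field_simp
          rw [this]
          gcongr ?_ / _
          linarith
        refine (mul_le_mul' (measure_mono (Ici_subset_Ici.2 h1)) (ih (G.bot z))).trans
          (le_of_eq ?_)
        ring
    · exact ih _

/-- An epoch is `2 Δ / σ`-differentially private. -/
theorem epochLaw_le (m : ℕ) (z : Z) :
    G.epochLaw s m z ≤ ENNReal.ofReal (Real.exp (2 * Δ / G.σ)) • G.epochLaw s' m z := by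
  have hΔ : 0 ≤ Δ := (abs_nonneg _).trans (hs z).1
  refine Measure.le_iff.2 fun t ht => ?_
  have hm : Measurable (t.indicator (1 : Bool × ℕ × Z → ENNReal)) := measurable_one.indicator ht
  rw [Measure.smul_apply, smul_eq_mul, ← lintegral_indicator_one ht, ← lintegral_indicator_one ht,
    G.lintegral_epochLaw s hm, G.lintegral_epochLaw s' hm]
  have hm' : Measurable fun ρ : ℝ => ∫⁻ ω, t.indicator 1 ω ∂G.epoch s' m z ρ :=
    (G.measurable_lintegral_epoch s' hm m).comp (measurable_const.prodMk measurable_id)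
  calc ∫⁻ ρ, ∫⁻ ω, t.indicator 1 ω ∂G.epoch s m z ρ ∂laplace
      ≤ ∫⁻ ρ, ENNReal.ofReal (Real.exp (Δ / (2 * G.σ) + Δ / G.σ)) *
          ∫⁻ ω, t.indicator 1 ω ∂G.epoch s' m z (ρ + Δ / (2 * G.σ)) ∂laplace :=
        lintegral_mono fun ρ => G.lintegral_epoch_le hσ hs hm m z ρ
    _ = ENNReal.ofReal (Real.exp (Δ / (2 * G.σ) + Δ / G.σ)) *
          ∫⁻ ρ, ∫⁻ ω, t.indicator 1 ω ∂G.epoch s' m z (ρ + Δ / (2 * G.σ)) ∂laplace :=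
        lintegral_const_mul _ (hm'.comp (measurable_id.add_const _))
    -- Undoing the shift of the fresh threshold noise costs another Δ/(2σ), for a total of 2Δ/σ.
    _ ≤ ENNReal.ofReal (Real.exp (Δ / (2 * G.σ) + Δ / G.σ)) *
          (ENNReal.ofReal (Real.exp |Δ / (2 * G.σ)|) *
            ∫⁻ ρ, ∫⁻ ω, t.indicator 1 ω ∂G.epoch s' m z ρ ∂laplace) := by
        gcongr
        exact lintegral_laplace_add_le hm' _
    _ = _ := by
        rw [← mul_assoc, ← ENNReal.ofReal_mul (Real.exp_pos _).le, ← Real.exp_add,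
          abs_of_nonneg (by positivity)]
        congr 4
        field_simp
        ring

omit hσ hs

/-! ### Composition of epochs -/

/-- The value of the terminal reward `f` when `m` steps are left, the state is `z`, and at most `b`
more tests may succeed; after the last success all states count as idle. -/
def value (s : Stat Z) (f : Z → ENNReal) : ℕ → ℕ → Z → ENNReal
  | 0, m, z => f (G.idle^[m] z)
  | b + 1, m, z => ∫⁻ ω, (if ω.1 then value s f b ω.2.1 ω.2.2 else f ω.2.2) ∂G.epochLaw s m z

theorem measurable_reward {f : Z → ENNReal} (hf : Measurable f) {g : ℕ → Z → ENNReal}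
    (hg : ∀ m, Measurable (g m)) :
    Measurable fun ω : Bool × ℕ × Z => if ω.1 then g ω.2.1 ω.2.2 else f ω.2.2 := by
  refine Measurable.ite (measurable_fst (measurableSet_singleton true)) ?_
    (hf.comp (measurable_snd.comp measurable_snd))
  exact (measurable_from_prod_countable_right (f := fun p : ℕ × Z => g p.1 p.2) hg).comp
    measurable_snd

theorem measurable_value {f : Z → ENNReal} (hf : Measurable f) (b m : ℕ) :
    Measurable (G.value s f b m) := by
  induction b generalizing m with
  | zero => exact hf.comp (G.measurable_idle.iterate m)
  | succ b ih => exact G.measurable_lintegral_epochLaw s (measurable_reward hf ih) m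

theorem value_mono {f g : Z → ENNReal} (h : f ≤ g) (b m : ℕ) (z : Z) :
    G.value s f b m z ≤ G.value s g b m z := by
  induction b generalizing m z with
  | zero => exact h _
  | succ b ih =>
    refine lintegral_mono fun ω => ?_
    dsimp only
    split_ifs
    exacts [ih _ _, h _]

include hσ hs

/-- Induction on the number of epochs. The Hölder step for the first epoch raises the bound for the
later ones to the power `r`, which cancels their root 1/r, so each epoch contributes one factor `K`.
If the game ends without a success the unused factors are harmless because `K ≥ 1`. -/
theorem value_le_rpow (hΔ : 0 < Δ) {α r : ℝ} (hαr : α.HolderConjugate r) {f : Z → ENNReal}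
    (hf : Measurable f) (b m : ℕ) (z : Z) :
    G.value s f b m z ≤
      (ENNReal.ofReal (Real.exp ((α - 1 / 2) ^ 2 * (2 * Δ / G.σ) ^ 2 / 2)) ^ (1 / α)) ^ b *
        G.value s' (fun w => f w ^ r) b m z ^ (1 / r) := by
  set K := ENNReal.ofReal (Real.exp ((α - 1 / 2) ^ 2 * (2 * Δ / G.σ) ^ 2 / 2)) ^ (1 / α) with hK
  have hr : r ≠ 0 := hαr.symm.ne_zero
  have hK1 : 1 ≤ K := by
    refine ENNReal.one_le_rpow ?_ (one_div_pos.2 hαr.pos)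
    rw [ENNReal.one_le_ofReal]
    exact Real.one_le_exp (by positivity)
  have hroot : ∀ x : ENNReal, (x ^ r) ^ (1 / r) = x := fun x => by
    rw [← ENNReal.rpow_mul, mul_one_div_cancel hr, ENNReal.rpow_one]
  have hroot' : ∀ x : ENNReal, (x ^ (1 / r)) ^ r = x := fun x => by
    rw [← ENNReal.rpow_mul, one_div_mul_cancel hr, ENNReal.rpow_one]
  have hfr : Measurable fun w => f w ^ r := hf.pow_const r
  induction b generalizing m z with
  | zero => simp only [value, pow_zero, one_mul, hroot, le_refl]
  | succ b ih =>
    have hstep := lintegral_le_of_bounded_ratio (ε := 2 * Δ / G.σ) (by positivity)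
      (G.epochLaw_le hσ hs m z) (G.epochLaw_le hσ hs.symm m z) hαr
      (measurable_reward hf (fun m => G.measurable_value (s := s) hf b m))
    refine hstep.trans ?_
    rw [← hK, pow_succ', mul_assoc]
    gcongr
    have hb : (K ^ b) = ((K ^ b) ^ r) ^ (1 / r) := (hroot _).symm
    rw [value, hb, ← ENNReal.mul_rpow_of_nonneg _ _ (one_div_nonneg.2 hαr.symm.nonneg),
      ← lintegral_const_mul _ (measurable_reward hfr
        (fun m => G.measurable_value (s := s') hfr b m))]
    refine ENNReal.rpow_le_rpow (lintegral_mono fun ω => ?_) (one_div_nonneg.2 hαr.symm.nonneg)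
    dsimp only
    split_ifs
    · refine (ENNReal.rpow_le_rpow (ih ω.2.1 ω.2.2) hαr.symm.nonneg).trans ?_
      rw [ENNReal.mul_rpow_of_nonneg _ _ hαr.symm.nonneg, hroot']
    · exact le_mul_of_one_le_left' (ENNReal.one_le_rpow (one_le_pow₀ hK1) hαr.symm.pos)

/-- The whole game is `(ε, δ)`-differentially private. -/
theorem value_le_exp_mul_add (hΔ : 0 < Δ) {α : ℝ} (hα : 1 < α) {f : Z → ENNReal}
    (hf : Measurable f) (hf1 : ∀ z, f z ≤ 1) (b m : ℕ) (z : Z) (ε : ℝ) :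
    G.value s f b m z ≤ ENNReal.ofReal (Real.exp ε) * G.value s' f b m z +
      ENNReal.ofReal (Real.exp (b * ((α - 1 / 2) ^ 2 * (2 * Δ / G.σ) ^ 2 / 2) - (α - 1) * ε)) := by
  set r := α.conjExponent with hr
  have hαr : α.HolderConjugate r := Real.HolderConjugate.conjExponent hα
  set k := (α - 1 / 2) ^ 2 * (2 * Δ / G.σ) ^ 2 / 2 with hk
  have h1 := G.value_le_rpow hσ hs hΔ hαr hf b m z
  -- Rewards are at most 1 and `r ≥ 1`, so the power may be dropped.
  have h2 : G.value s' (fun w => f w ^ r) b m z ≤ G.value s' f b m z :=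
    G.value_mono (fun w => ENNReal.rpow_le_self_of_le_one (hf1 w) hαr.symm.lt.le) b m z
  set y := G.value s' f b m z
  have hα0 : 0 < α := hαr.pos
  have hr0 : 0 < r := hαr.symm.pos
  refine h1.trans ((mul_le_mul_right (ENNReal.rpow_le_rpow h2
    (one_div_nonneg.2 hαr.symm.nonneg)) _).trans ?_)
  have hinv : 1 / r = 1 - 1 / α := by
    have := hαr.inv_add_inv_eq_one
    rw [one_div, one_div]
    linarith
  -- The factor e^{ε/r} is moved onto `y` and compensated in the other term, so that Young's
  -- inequality with weights 1/α and 1/r yields exactly the two summands wanted.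
  have e1 : (ENNReal.ofReal (Real.exp k) ^ (1 / α)) ^ b * y ^ (1 / r) =
      ENNReal.ofReal (Real.exp (b * k - (α - 1) * ε)) ^ (1 / α) *
        (ENNReal.ofReal (Real.exp ε) * y) ^ (1 / r) := by
    rw [ENNReal.mul_rpow_of_nonneg _ _ (one_div_nonneg.2 hαr.symm.nonneg), ← mul_assoc]
    congr 1
    rw [ENNReal.ofReal_rpow_of_pos (Real.exp_pos _), ENNReal.ofReal_rpow_of_pos (Real.exp_pos _),
      ENNReal.ofReal_rpow_of_pos (Real.exp_pos _), ← Real.exp_mul, ← Real.exp_mul, ← Real.exp_mul,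
      ← ENNReal.ofReal_mul (Real.exp_pos _).le, ← Real.exp_add,
      ← ENNReal.ofReal_pow (Real.exp_pos _).le, ← Real.exp_nat_mul, hinv]
    congr 2
    field_simp
    ring
  rw [e1]
  refine (ENNReal.young_inequality _ _ hαr).trans ?_
  have hroot : ∀ {t : ℝ} (_ : t ≠ 0) (x : ENNReal), (x ^ (1 / t)) ^ t = x := fun ht x => by
    rw [← ENNReal.rpow_mul, one_div_mul_cancel ht, ENNReal.rpow_one]
  rw [hroot hα0.ne', hroot hr0.ne', add_comm]
  refine add_le_add ?_ ?_
  · exact ENNReal.div_le_of_le_mul (le_mul_of_one_le_right'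
      (ENNReal.one_le_ofReal.2 hαr.symm.lt.le))
  · exact ENNReal.div_le_of_le_mul (le_mul_of_one_le_right'
      (ENNReal.one_le_ofReal.2 hα.le))

end SparseGame

/-! ### The noise tapes -/

/-- The three noise tapes `ρ`, `λ`, `ξ` of a round. -/
abbrev Noise : Type := (ℕ → ℝ) × (ℕ → ℝ) × (ℕ → ℝ)

def laplaceTape : Measure (ℕ → ℝ) := Measure.infinitePi fun _ : ℕ => laplace

instance : IsProbabilityMeasure laplaceTape := by
  unfold laplaceTape
  infer_instance

def noiseLaw : Measure Noise := laplaceTape.prod (laplaceTape.prod laplaceTape)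

instance : IsProbabilityMeasure noiseLaw := by
  unfold noiseLaw
  infer_instance

theorem lintegral_laplaceTape_prod_update {Y : Type*} [MeasurableSpace Y] (ν : Measure Y)
    [IsProbabilityMeasure ν] (i : ℕ) {F : (ℕ → ℝ) × Y → ENNReal} (hF : Measurable F) :
    ∫⁻ p, F p ∂laplaceTape.prod ν =
      ∫⁻ p, ∫⁻ x, F (Function.update p.1 i x, p.2) ∂laplace ∂laplaceTape.prod ν := by
  have hu : Measurable fun q : ((ℕ → ℝ) × Y) × ℝ => (Function.update q.1.1 i q.2, q.1.2) :=
    ((measurable_update' (a := i)).comp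
      ((measurable_fst.comp measurable_fst).prodMk measurable_snd)).prodMk
      (measurable_snd.comp measurable_fst)
  rw [lintegral_prod _ hF.aemeasurable, lintegral_prod _
    ((hF.comp hu).lintegral_prod_right' (f := fun q : ((ℕ → ℝ) × Y) × ℝ =>
      F (Function.update q.1.1 i q.2, q.1.2))).aemeasurable, laplaceTape,
    lintegral_infinitePi_update _ i hF.lintegral_prod_right']
  refine lintegral_congr fun a => ?_
  rw [lintegral_lintegral_swap]
  exact (hF.comp (((measurable_update' (a := i)).comp
    (measurable_const.prodMk measurable_fst)).prodMk measurable_snd)).aemeasurable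

theorem lintegral_noise_rho (i : ℕ) {F : Noise → ENNReal} (hF : Measurable F) :
    ∫⁻ n, F n ∂noiseLaw =
      ∫⁻ n, ∫⁻ x, F (Function.update n.1 i x, n.2) ∂laplace ∂noiseLaw :=
  lintegral_laplaceTape_prod_update _ i hF

theorem lintegral_noise_lam (i : ℕ) {F : Noise → ENNReal} (hF : Measurable F) :
    ∫⁻ n, F n ∂noiseLaw =
      ∫⁻ n, ∫⁻ x, F (n.1, Function.update n.2.1 i x, n.2.2) ∂laplace ∂noiseLaw := by
  have hu : Measurable fun q : Noise × ℝ =>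
      (q.1.1, Function.update q.1.2.1 i q.2, q.1.2.2) :=
    (measurable_fst.comp measurable_fst).prodMk (((measurable_update' (a := i)).comp
      ((by fun_prop : Measurable fun q : Noise × ℝ => q.1.2.1).prodMk measurable_snd)).prodMk
      (by fun_prop))
  rw [noiseLaw, lintegral_prod _ hF.aemeasurable, lintegral_prod _
    ((hF.comp hu).lintegral_prod_right' (f := fun q : Noise × ℝ =>
      F (q.1.1, Function.update q.1.2.1 i q.2, q.1.2.2))).aemeasurable]
  refine lintegral_congr fun a => ?_
  exact lintegral_laplaceTape_prod_update _ i (hF.comp measurable_prodMk_left)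

theorem lintegral_noise_xi (i : ℕ) {F : Noise → ENNReal} (hF : Measurable F) :
    ∫⁻ n, F n ∂noiseLaw =
      ∫⁻ n, ∫⁻ x, F (n.1, n.2.1, Function.update n.2.2 i x) ∂laplace ∂noiseLaw := by
  have hu : Measurable fun q : Noise × ℝ =>
      (q.1.1, q.1.2.1, Function.update q.1.2.2 i q.2) :=
    (measurable_fst.comp measurable_fst).prodMk ((by fun_prop : Measurable fun q : Noise × ℝ =>
      q.1.2.1).prodMk ((measurable_update' (a := i)).comp
      ((by fun_prop : Measurable fun q : Noise × ℝ => q.1.2.2).prodMk measurable_snd)))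
  have hG := (hF.comp hu).lintegral_prod_right' (f := fun q : Noise × ℝ =>
      F (q.1.1, q.1.2.1, Function.update q.1.2.2 i q.2)) (ν := laplace)
  rw [noiseLaw, lintegral_prod _ hF.aemeasurable, lintegral_prod _ hG.aemeasurable]
  refine lintegral_congr fun a => ?_
  rw [lintegral_prod (fun b => F (a, b)) (hF.comp measurable_prodMk_left).aemeasurable,
    lintegral_prod (fun b : (ℕ → ℝ) × (ℕ → ℝ) =>
      ∫⁻ x, F (a, b.1, Function.update b.2 i x) ∂laplace)
      (hG.comp measurable_prodMk_left).aemeasurable]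
  refine lintegral_congr fun l => ?_
  exact lintegral_infinitePi_update (fun _ : ℕ => laplace) i
    (hF.comp (measurable_prodMk_left.comp measurable_prodMk_left))

/-! ### The sparse vector game driven by noise tapes -/

namespace SparseGame

variable {Z : Type*} [MeasurableSpace Z] (G : SparseGame Z) (s : Stat Z)

open Classical in
/-- The state after `m` steps from `z` in the game played with the noise tapes `n`, of which the
entries before `k` (for `ρ`) and before `l` (for `λ` and `ξ`) have been used up, when at most `b`
more tests may succeed. -/
def play (n : Noise) : ℕ → ℕ → ℕ → ℕ → Z → Z
  | 0, _, _, _, z => z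
  | m + 1, b, k, l, z =>
    if z ∈ G.act ∧ 0 < b then
      if n.2.1 l < (s.c z - 2 * G.σ * n.1 k) / (4 * G.σ) then
        play n m (b - 1) (k + 1) (l + 1) (G.top (z, s.e z + G.σ * n.2.2 l))
      else play n m b k (l + 1) (G.bot z)
    else play n m b k l (G.idle z)

theorem measurable_play (m b k l : ℕ) :
    Measurable fun p : Noise × Z => G.play s p.1 m b k l p.2 := by
  classical
  induction m generalizing b k l with
  | zero => exact measurable_snd
  | succ m ih =>
    simp only [play]
    have hk : Measurable fun p : Noise × Z => p.1.1 k := by fun_prop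
    have hl : Measurable fun p : Noise × Z => p.1.2.1 l := by fun_prop
    have hx : Measurable fun p : Noise × Z => p.1.2.2 l := by fun_prop
    have hc : Measurable fun p : Noise × Z => s.c p.2 := s.measurable_c.comp measurable_snd
    have he : Measurable fun p : Noise × Z => s.e p.2 := s.measurable_e.comp measurable_snd
    refine Measurable.ite ?_ (Measurable.ite ?_ ?_ ?_) ?_
    · exact (measurable_snd G.measurableSet_act).inter (MeasurableSet.const _)
    · exact measurableSet_lt hl ((hc.sub (hk.const_mul _)).div_const _)
    · exact (ih _ _ _).comp (measurable_fst.prodMk (G.measurable_top.comp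
        (measurable_snd.prodMk (he.add (hx.const_mul _)))))
    · exact (ih _ _ _).comp (measurable_fst.prodMk (G.measurable_bot.comp measurable_snd))
    · exact (ih _ _ _).comp (measurable_fst.prodMk (G.measurable_idle.comp measurable_snd))

theorem measurable_reward_play {f : Z → ENNReal} (hf : Measurable f) {Y : Type*}
    [MeasurableSpace Y] {g : Y → Noise} {h : Y → Z} (hg : Measurable g) (hh : Measurable h)
    (m b k l : ℕ) : Measurable fun y => f (G.play s (g y) m b k l (h y)) :=
  hf.comp ((G.measurable_play s m b k l).comp (hg.prodMk hh))

/-- Noise entries already consumed are never read again; this makes later noises fresh. -/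
theorem play_congr {n n' : Noise} (m b : ℕ) {k l : ℕ} (z : Z)
    (h1 : ∀ i, k ≤ i → n.1 i = n'.1 i) (h2 : ∀ i, l ≤ i → n.2.1 i = n'.2.1 i)
    (h3 : ∀ i, l ≤ i → n.2.2 i = n'.2.2 i) :
    G.play s n m b k l z = G.play s n' m b k l z := by
  induction m generalizing b k l z with
  | zero => rfl
  | succ m ih =>
    simp only [play, h1 k le_rfl, h2 l le_rfl, h3 l le_rfl]
    rw [ih (b - 1) _ (fun i hi => h1 i (by omega)) (fun i hi => h2 i (by omega))
        (fun i hi => h3 i (by omega)),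
      ih b (G.bot z) h1 (fun i hi => h2 i (by omega)) (fun i hi => h3 i (by omega)),
      ih b (G.idle z) h1 h2 h3]

theorem play_zero_budget (n : Noise) (m k l : ℕ) (z : Z) :
    G.play s n m 0 k l z = G.idle^[m] z := by
  induction m generalizing z with
  | zero => rfl
  | succ m ih => simp [play, ih]

variable {s}

/-- One threshold noise serves a whole epoch, so entry `k` is pinned to `ρ` while the tests of the
epoch are unfolded; `ih` takes over after the success. -/
theorem lintegral_play_update {f : Z → ENNReal} (hf : Measurable f) {b : ℕ}
    (ih : ∀ m k l z, ∫⁻ n, f (G.play s n m b k l z) ∂noiseLaw = G.value s f b m z)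
    (m k l : ℕ) (z : Z) (ρ : ℝ) :
    ∫⁻ n, f (G.play s (Function.update n.1 k ρ, n.2) m (b + 1) k l z) ∂noiseLaw =
      ∫⁻ ω, (if ω.1 then G.value s f b ω.2.1 ω.2.2 else f ω.2.2) ∂G.epoch s m z ρ := by
  classical
  have hR := measurable_reward hf (G.measurable_value (s := s) hf b)
  induction m generalizing l z with
  | zero =>
    simp only [play, epoch]
    rw [lintegral_dirac' _ hR]
    simp
  | succ m ihm =>
    rw [G.lintegral_epoch_succ s hR]
    by_cases hz : z ∈ G.act
    · rw [if_pos hz, ← lintegral_laplace_ite]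
      have hrho : Measurable fun n : Noise => (Function.update n.1 k ρ, n.2) :=
        (measurable_update'.comp (measurable_fst.prodMk measurable_const)).prodMk measurable_snd
      have hm1 : Measurable fun n : Noise =>
          f (G.play s (Function.update n.1 k ρ, n.2) (m + 1) (b + 1) k l z) :=
        G.measurable_reward_play s hf hrho measurable_const _ _ _ _
      rw [lintegral_noise_lam l hm1]
      have hlam : Measurable fun q : Noise × ℝ =>
          ((q.1.1, Function.update q.1.2.1 l q.2, q.1.2.2) : Noise) :=
        (measurable_fst.comp measurable_fst).prodMk (((measurable_update' (a := l)).comp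
          ((by fun_prop : Measurable fun q : Noise × ℝ => q.1.2.1).prodMk measurable_snd)).prodMk
          (by fun_prop))
      rw [lintegral_lintegral_swap (f := fun (n : Noise) (x : ℝ) => f (G.play s
        (Function.update n.1 k ρ, Function.update n.2.1 l x, n.2.2) (m + 1) (b + 1) k l z))
        (hm1.comp hlam).aemeasurable]
      refine lintegral_congr fun x => ?_
      have hlamx : Measurable fun n : Noise =>
          ((n.1, Function.update n.2.1 l x, n.2.2) : Noise) :=
        hlam.comp (measurable_id.prodMk measurable_const)
      split_ifs with hx
      · rw [lintegral_noise_xi l (F := fun n => f (G.play s (Function.update n.1 k ρ,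
          Function.update n.2.1 l x, n.2.2) (m + 1) (b + 1) k l z)) (hm1.comp hlamx)]
        -- After the success the counters are past `k` and `l`, so the altered entries no longer
        -- matter.
        have heq : ∀ (n : Noise) (y : ℝ),
            f (G.play s (Function.update n.1 k ρ, Function.update n.2.1 l x,
              Function.update n.2.2 l y) (m + 1) (b + 1) k l z) =
            f (G.play s n m b (k + 1) (l + 1) (G.top (z, s.e z + G.σ * y))) := by
          intro n y
          simp only [play, hz, true_and, Nat.succ_pos, if_true, Function.update_self, hx,
            Nat.add_sub_cancel]
          congr 1
          refine G.play_congr s m b _ (fun i hi => ?_) (fun i hi => ?_) (fun i hi => ?_) <;>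
          exact Function.update_of_ne (by omega) _ _
        simp only [heq]
        rw [lintegral_lintegral_swap]
        · exact lintegral_congr fun y => by simpa using ih m (k + 1) (l + 1) _
        · exact (G.measurable_reward_play s hf measurable_fst
            (G.measurable_top.comp (measurable_const.prodMk
              (measurable_const.add (measurable_snd.const_mul _)))) _ _ _ _).aemeasurable
      · rw [← ihm (l + 1) (G.bot z)]
        refine lintegral_congr fun n => ?_
        simp only [play, hz, true_and, Nat.succ_pos, if_true, Function.update_self, hx, if_false]
        congr 1
        refine G.play_congr s m (b + 1) _ (fun i _ => rfl) (fun i hi => ?_) (fun i _ => rfl)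
        exact Function.update_of_ne (by omega) _ _
    · rw [if_neg hz]
      simp only [play, hz, false_and, if_false]
      exact ihm l (G.idle z)

/-- With independent Laplace noises the expected reward of the game is its value. -/
theorem lintegral_play {f : Z → ENNReal} (hf : Measurable f) (b m k l : ℕ) (z : Z) :
    ∫⁻ n, f (G.play s n m b k l z) ∂noiseLaw = G.value s f b m z := by
  induction b generalizing m k l z with
  | zero => simp only [play_zero_budget, lintegral_const, measure_univ, mul_one, value]
  | succ b ih =>
    have hm : Measurable fun n : Noise => f (G.play s n m (b + 1) k l z) :=
      G.measurable_reward_play s hf measurable_id measurable_const _ _ _ _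
    have hrho : Measurable fun q : Noise × ℝ => ((Function.update q.1.1 k q.2, q.1.2) : Noise) :=
      ((measurable_update' (a := k)).comp
        ((by fun_prop : Measurable fun q : Noise × ℝ => q.1.1).prodMk measurable_snd)).prodMk
        (by fun_prop)
    rw [lintegral_noise_rho k hm, lintegral_lintegral_swap (f := fun (n : Noise) (x : ℝ) =>
      f (G.play s (Function.update n.1 k x, n.2) m (b + 1) k l z)) (hm.comp hrho).aemeasurable,
      value,
      G.lintegral_epochLaw s (measurable_reward hf (G.measurable_value hf b))]
    exact lintegral_congr fun ρ => G.lintegral_play_update hf ih m k l z ρ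

/-- Differential privacy of the game played with the noise tapes. -/
theorem lintegral_play_le (hσ : 0 < G.σ) {s' : Stat Z} {Δ : ℝ} (hs : Stat.Close Δ s s')
    (hΔ : 0 < Δ) {α : ℝ} (hα : 1 < α) {f : Z → ENNReal} (hf : Measurable f) (hf1 : ∀ z, f z ≤ 1)
    (b m k l : ℕ) (z : Z) (ε : ℝ) :
    ∫⁻ n, f (G.play s n m b k l z) ∂noiseLaw ≤
      ENNReal.ofReal (Real.exp ε) * ∫⁻ n, f (G.play s' n m b k l z) ∂noiseLaw +
      ENNReal.ofReal (Real.exp (b * ((α - 1 / 2) ^ 2 * (2 * Δ / G.σ) ^ 2 / 2) - (α - 1) * ε)) := by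
  rw [G.lintegral_play hf, G.lintegral_play hf]
  exact G.value_le_exp_mul_add hσ hs hΔ hα hf hf1 b m z ε

end SparseGame

/-! ### The interaction as a function of the replies -/

instance : MeasurableSpace RoundState := ⊤

instance : DiscreteMeasurableSpace RoundState := ⟨fun _ => trivial⟩

instance : Countable RoundState :=
  Function.Injective.countable (f := fun s : RoundState => (s.t, s.answered, s.overfit))
    fun ⟨_, _, _⟩ ⟨_, _, _⟩ h => by simpa using h

section Replay

variable {X Θ U : Type*}

/-- The history and the state after one more query, with its reply. -/
def extend (P : Params) {i : ℕ} (x : (Fin i → Record Θ) × RoundState) (θ : Θ) (r : Bool × ℝ) :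
    (Fin (i + 1) → Record Θ) × RoundState :=
  (Fin.snoc (α := fun _ => Record Θ) x.1 (θ, r.2, price P x.2.t r.1), nextState P x.2 r.1)

/-- The history and the state after the replies `y 0, ..., y (i - 1)`. -/
def replay (P : Params) (R : ∀ i : ℕ, (Fin i → Record Θ) → Θ) (y : ℕ → Bool × ℝ) :
    (i : ℕ) → (Fin i → Record Θ) × RoundState
  | 0 => (Fin.elim0, startRound P 0)
  | i + 1 => extend P (replay P R y i) (R i (replay P R y i).1) (y i)

theorem replay_congr (P : Params) (R : ∀ i : ℕ, (Fin i → Record Θ) → Θ) {y y' : ℕ → Bool × ℝ}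
    {i : ℕ} (h : ∀ j < i, y j = y' j) : replay P R y i = replay P R y' i := by
  induction i with
  | zero => rfl
  | succ i ih =>
    rw [replay, replay, ih fun j hj => h j (by omega), h i (by omega)]

/-- The replies of the mechanism. -/
def replies (P : Params) (q : Θ → X → ℝ) (R : ∀ i : ℕ, (Fin i → Record Θ) → Θ)
    (tape : ℕ → RoundTape X) (i : ℕ) : Bool × ℝ :=
  (reply P tape (run P q R tape i).2 (q (R i (run P q R tape i).1))).swap

theorem run_succ (P : Params) (q : Θ → X → ℝ) (R : ∀ i : ℕ, (Fin i → Record Θ) → Θ)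
    (tape : ℕ → RoundTape X) (i : ℕ) :
    run P q R tape (i + 1) =
      extend P (run P q R tape i) (R i (run P q R tape i).1) (replies P q R tape i) :=
  rfl

theorem run_eq_replay (P : Params) (q : Θ → X → ℝ) (R : ∀ i : ℕ, (Fin i → Record Θ) → Θ)
    (tape : ℕ → RoundTape X) (i : ℕ) :
    run P q R tape i = replay P R (replies P q R tape) i := by
  induction i with
  | zero => rfl
  | succ i ih => rw [run_succ, replay, ← ih]

theorem query_eq (P : Params) (q : Θ → X → ℝ) (R : ∀ i : ℕ, (Fin i → Record Θ) → Θ)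
    (tape : ℕ → RoundTape X) (i : ℕ) :
    query P q R tape i = q (R i (run P q R tape i).1) := by
  simp [query, record, run_succ, extend]

theorem answer_eq (P : Params) (q : Θ → X → ℝ) (R : ∀ i : ℕ, (Fin i → Record Θ) → Θ)
    (tape : ℕ → RoundTape X) (i : ℕ) :
    answer P q R tape i = (replies P q R tape i).2 := by
  simp [answer, record, run_succ, extend]

/-! ### Measurability of the interaction -/

variable [MeasurableSpace X] [MeasurableSpace Θ] [MeasurableSpace U]

theorem measurable_of_state_flag {α : Type*} [MeasurableSpace α] (g : RoundState → Bool → α)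
    (i : ℕ) : Measurable fun p : ((Fin i → Record Θ) × RoundState) × Θ × (Bool × ℝ) =>
      g p.1.2 p.2.2.1 := by
  have hs : Measurable fun p : ((Fin i → Record Θ) × RoundState) × Θ × (Bool × ℝ) =>
      (p.1.2, p.2.2.1) :=
    (measurable_snd.comp measurable_fst).prodMk
      (measurable_fst.comp (measurable_snd.comp measurable_snd))
  exact (Measurable.of_discrete (f := fun w : RoundState × Bool => g w.1 w.2)).comp hs

theorem measurable_extend (P : Params) (i : ℕ) :
    Measurable fun p : ((Fin i → Record Θ) × RoundState) × Θ × (Bool × ℝ) =>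
      extend P p.1 p.2.1 p.2.2 := by
  have hprice : Measurable fun p : ((Fin i → Record Θ) × RoundState) × Θ × (Bool × ℝ) =>
      price P p.1.2.t p.2.2.1 := measurable_of_state_flag (fun s o => price P s.t o) i
  have hnext := measurable_of_state_flag (Θ := Θ) (nextState P) i
  have hsnoc : Measurable fun p : ((Fin i → Record Θ) × RoundState) × Θ × (Bool × ℝ) =>
      Fin.snoc (α := fun _ => Record Θ) p.1.1 (p.2.1, p.2.2.2, price P p.1.2.t p.2.2.1) := by
    refine measurable_pi_lambda _ fun j => ?_
    refine Fin.lastCases ?_ (fun j => ?_) j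
    · simp only [Fin.snoc_last]
      exact (measurable_fst.comp measurable_snd).prodMk
        ((measurable_snd.comp (measurable_snd.comp measurable_snd)).prodMk hprice)
    · simp only [Fin.snoc_castSucc]
      exact (measurable_pi_apply j).comp (measurable_fst.comp measurable_fst)
  unfold extend
  exact hsnoc.prodMk hnext

theorem measurable_replay (P : Params) {R : ∀ i : ℕ, U → (Fin i → Record Θ) → Θ}
    (hR : ∀ i, Measurable (Function.uncurry (R i))) (i : ℕ) :
    Measurable fun p : U × (ℕ → Bool × ℝ) => replay P (fun i => R i p.1) p.2 i := by
  induction i with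
  | zero => exact measurable_const
  | succ i ih =>
    exact (measurable_extend P i).comp (ih.prodMk (((hR i).comp (measurable_fst.prodMk
      (measurable_fst.comp ih))).prodMk ((measurable_pi_apply i).comp measurable_snd)))

theorem measurable_empMean {q : Θ → X → ℝ} (hq : Measurable (Function.uncurry q)) (N : ℕ) :
    Measurable fun p : (ℕ → X) × Θ => empMean N p.1 (q p.2) := by
  refine Measurable.div_const (Finset.measurable_sum _ fun j _ => ?_) _
  exact hq.comp (measurable_snd.prodMk ((measurable_pi_apply j).comp measurable_fst))

open Classical in
theorem measurable_thresholdoutReply (ζ : ℝ) :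
    Measurable fun p : ℝ × ℝ × ℝ × ℝ × ℝ =>
      thresholdoutReply ζ p.1 p.2.1 p.2.2.1 p.2.2.2.1 p.2.2.2.2 := by
  unfold thresholdoutReply
  have h : MeasurableSet {p : ℝ × ℝ × ℝ × ℝ × ℝ |
      |p.1 - p.2.1| > ζ + p.2.2.1 + p.2.2.2.1} := by
    refine measurableSet_lt (by fun_prop) ?_
    have : Measurable fun p : ℝ × ℝ × ℝ × ℝ × ℝ => p.1 - p.2.1 := by fun_prop
    exact continuous_abs.measurable.comp this
  exact Measurable.ite h (by fun_prop) (by fun_prop)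

theorem measurable_reply (P : Params) {q : Θ → X → ℝ} (hq : Measurable (Function.uncurry q)) :
    Measurable fun p : RoundState × (ℕ → RoundTape X) × Θ => reply P p.2.1 p.1 (q p.2.2) := by
  refine measurable_from_prod_countable_right fun s => ?_
  have hr : Measurable fun p : (ℕ → RoundTape X) × Θ => p.1 s.t :=
    (measurable_pi_apply s.t).comp measurable_fst
  have hS : Measurable fun p : (ℕ → RoundTape X) × Θ => (p.1 s.t).S := measurable_fst.comp hr
  have hT : Measurable fun p : (ℕ → RoundTape X) × Θ => (p.1 s.t).T :=
    measurable_fst.comp (measurable_snd.comp hr)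
  have h1 : Measurable fun p : (ℕ → RoundTape X) × Θ => (p.1 s.t).rho s.overfit :=
    (measurable_pi_apply _).comp (measurable_fst.comp
      (measurable_snd.comp (measurable_snd.comp hr)))
  have h2 : Measurable fun p : (ℕ → RoundTape X) × Θ => (p.1 s.t).lam s.answered :=
    (measurable_pi_apply _).comp (measurable_fst.comp
      (measurable_snd.comp (measurable_snd.comp (measurable_snd.comp hr))))
  have h3 : Measurable fun p : (ℕ → RoundTape X) × Θ => (p.1 s.t).xi s.answered :=
    (measurable_pi_apply _).comp (measurable_snd.comp
      (measurable_snd.comp (measurable_snd.comp (measurable_snd.comp hr))))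
  have h := (measurable_thresholdoutReply P.ζ).comp
    (((measurable_empMean hq (P.size s.t)).comp (hS.prodMk measurable_snd)).prodMk
      (((measurable_empMean hq (P.size s.t)).comp (hT.prodMk measurable_snd)).prodMk
        ((h1.const_mul (2 * P.σ s.t)).prodMk
          ((h2.const_mul (4 * P.σ s.t)).prodMk (h3.const_mul (P.σ s.t))))))
  simp only [Function.comp_def] at h
  unfold reply
  exact h

theorem measurable_reply_run (P : Params) {q : Θ → X → ℝ} (hq : Measurable (Function.uncurry q))
    {R : ∀ i : ℕ, U → (Fin i → Record Θ) → Θ} (hR : ∀ i, Measurable (Function.uncurry (R i)))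
    {i : ℕ} (h : Measurable fun ω : U × (ℕ → RoundTape X) => run P q (fun i => R i ω.1) ω.2 i) :
    Measurable fun ω : U × (ℕ → RoundTape X) => replies P q (fun i => R i ω.1) ω.2 i := by
  have h := measurable_swap.comp ((measurable_reply P hq).comp ((measurable_snd.comp h).prodMk
    (measurable_snd.prodMk ((hR i).comp (measurable_fst.prodMk (measurable_fst.comp h))))))
  simp only [Function.comp_def, Function.uncurry] at h
  exact h

theorem measurable_run (P : Params) {q : Θ → X → ℝ} (hq : Measurable (Function.uncurry q))
    {R : ∀ i : ℕ, U → (Fin i → Record Θ) → Θ} (hR : ∀ i, Measurable (Function.uncurry (R i)))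
    (i : ℕ) :
    Measurable fun ω : U × (ℕ → RoundTape X) => run P q (fun i => R i ω.1) ω.2 i := by
  induction i with
  | zero => exact measurable_const
  | succ i ih =>
    exact (measurable_extend P i).comp (ih.prodMk (((hR i).comp (measurable_fst.prodMk
      (measurable_fst.comp ih))).prodMk (measurable_reply_run P hq hR ih)))

theorem measurable_replies (P : Params) {q : Θ → X → ℝ} (hq : Measurable (Function.uncurry q))
    {R : ∀ i : ℕ, U → (Fin i → Record Θ) → Θ} (hR : ∀ i, Measurable (Function.uncurry (R i))) :
    Measurable fun ω : U × (ℕ → RoundTape X) => replies P q (fun i => R i ω.1) ω.2 :=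
  measurable_pi_lambda _ fun i => measurable_reply_run P hq hR (measurable_run P hq hR i)

end Replay

/-! ### The rounds visited by the interaction -/

theorem startRound_spec {P : Params} (hP : ∀ t, ∃ s, t ≤ s ∧ ¬ Halted P ⟨s, 0, 0⟩) (t : ℕ) :
    t ≤ (startRound P t).t ∧ ¬ Halted P (startRound P t) :=
  Nat.sInf_mem (s := {s : ℕ | t ≤ s ∧ ¬ Halted P ⟨s, 0, 0⟩}) (hP t)

/-- Rounds only move forward, possibly skipping some, and each starts with zero counters. -/
theorem settle_spec {P : Params} (hP : ∀ t, ∃ s, t ≤ s ∧ ¬ Halted P ⟨s, 0, 0⟩)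
    (s : RoundState) : ¬ Halted P (settle P s) ∧
      (settle P s = s ∨ s.t < (settle P s).t ∧ (settle P s).answered = 0 ∧
        (settle P s).overfit = 0) := by
  unfold settle
  split_ifs with h
  · exact ⟨(startRound_spec hP _).2, Or.inr ⟨(startRound_spec hP (s.t + 1)).1, rfl, rfl⟩⟩
  · exact ⟨h, Or.inl rfl⟩

section Link

variable {X Θ : Type*} {P : Params} {q : Θ → X → ℝ} {R : ∀ i : ℕ, (Fin i → Record Θ) → Θ}
  {tape : ℕ → RoundTape X}

theorem run_not_halted (hP : ∀ t, ∃ s, t ≤ s ∧ ¬ Halted P ⟨s, 0, 0⟩) (i : ℕ) :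
    ¬ Halted P (run P q R tape i).2 := by
  cases i with
  | zero => exact (startRound_spec hP 0).2
  | succ i => exact (settle_spec hP _).1

/-- Threshold noises are indexed by `overfit`; this places the index in the range that
`moderateNoise` controls. -/
theorem run_overfit_le (hP : ∀ t, ∃ s, t ≤ s ∧ ¬ Halted P ⟨s, 0, 0⟩) (i : ℕ) :
    (run P q R tape i).2.overfit ≤ (run P q R tape i).2.answered := by
  induction i with
  | zero => exact le_rfl
  | succ i ih =>
    rw [run_succ]
    simp only [extend, nextState]
    rcases (settle_spec hP ⟨(run P q R tape i).2.t, (run P q R tape i).2.answered + 1,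
      if (replies P q R tape i).1 then (run P q R tape i).2.overfit + 1
        else (run P q R tape i).2.overfit⟩).2 with h | h
    · rw [h]
      dsimp only
      split_ifs <;> omega
    · omega

end Link

/-! ### One round as a sparse vector game -/

/-- The number of queries answered so far, and the replies to them (followed by anything). -/
abbrev Play : Type := ℕ × (ℕ → Bool × ℝ)

def Play.push (z : Play) (r : Bool × ℝ) : Play := (z.1 + 1, Function.update z.2 z.1 r)

def Play.take (y : ℕ → Bool × ℝ) (i : ℕ) : Play := (i, fun j => if j < i then y j else (false, 0))

theorem Play.push_take (y : ℕ → Bool × ℝ) (i : ℕ) :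
    (Play.take y i).push (y i) = Play.take y (i + 1) := by
  unfold Play.push Play.take
  refine Prod.ext rfl (funext fun j => ?_)
  by_cases hj : j = i
  · subst hj; simp
  · simp only [Function.update_of_ne hj]
    refine if_congr ?_ rfl rfl
    omega

theorem Play.measurable_push : Measurable fun p : Play × (Bool × ℝ) => p.1.push p.2 := by
  have h : Measurable fun p : ℕ × ((ℕ → Bool × ℝ) × (Bool × ℝ)) =>
      ((p.1 + 1, Function.update p.2.1 p.1 p.2.2) : Play) :=
    by
    refine measurable_from_prod_countable_right fun i => ?_
    have h : Measurable fun p : (ℕ → Bool × ℝ) × (Bool × ℝ) => Function.update p.1 i p.2 :=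
      measurable_update'
    exact (measurable_const (a := i + 1)).prodMk h
  exact h.comp ((measurable_fst.comp measurable_fst).prodMk
    ((measurable_snd.comp measurable_fst).prodMk measurable_snd))

section Round

variable {X Θ : Type*} [MeasurableSpace X] [MeasurableSpace Θ] (P : Params) {q : Θ → X → ℝ}
  (hq : Measurable (Function.uncurry q)) {R : ∀ i : ℕ, (Fin i → Record Θ) → Θ}
  (hR : ∀ i, Measurable (R i)) (tape : ℕ → RoundTape X) (t : ℕ) (S : ℕ → X)

variable (R) in
/-- The state in which the next query is posed. -/
def stateAt (z : Play) : RoundState := (replay P R z.2 z.1).2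

variable (R) in
/-- The next query. -/
def queryAt (z : Play) : Θ := R z.1 (replay P R z.2 z.1).1

include hR in
theorem measurable_replay_const (i : ℕ) : Measurable fun y => replay P R y i :=
  (measurable_replay (U := Unit) (R := fun i _ => R i) P
    (fun i => (hR i).comp measurable_snd) i).comp (measurable_const (a := ()).prodMk measurable_id)

include hR in
theorem measurable_stateAt : Measurable (stateAt P R) :=
  measurable_from_prod_countable_right fun i =>
    measurable_snd.comp (measurable_replay_const P hR i)

include hR in
theorem measurable_queryAt : Measurable (queryAt P R) :=
  measurable_from_prod_countable_right fun i =>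
    (hR i).comp (measurable_fst.comp (measurable_replay_const P hR i))

include hq hR in
theorem measurable_empMean_queryAt (N : ℕ) (T : ℕ → X) :
    Measurable fun z => empMean N T (q (queryAt P R z)) :=
  (measurable_empMean hq N).comp (measurable_const.prodMk (measurable_queryAt P hR))

/-- The interaction as a game in which the dataset `T` and the noises of round `t` are hidden. -/
def roundGame : SparseGame Play where
  act := {z | (stateAt P R z).t = t}
  bot z := z.push (false, empMean (P.size t) S (q (queryAt P R z)))
  top p := p.1.push (true, p.2)
  idle z := z.push (reply P tape (stateAt P R z) (q (queryAt P R z))).swap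
  σ := P.σ t
  measurableSet_act := measurable_stateAt P hR
    (MeasurableSet.of_discrete (s := {s : RoundState | s.t = t}))
  measurable_bot := Play.measurable_push.comp (measurable_id.prodMk
    (measurable_const.prodMk (measurable_empMean_queryAt P hq hR _ _)))
  measurable_top := Play.measurable_push.comp (measurable_fst.prodMk
    (measurable_const.prodMk measurable_snd))
  measurable_idle := Play.measurable_push.comp (measurable_id.prodMk
    (measurable_swap.comp ((measurable_reply P hq).comp ((measurable_stateAt P hR).prodMk
      (measurable_const.prodMk (measurable_queryAt P hR))))))

/-- The statistics of the dataset `T` in round `t`. -/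
def roundStat (T : ℕ → X) : Stat Play where
  c z := |empMean (P.size t) S (q (queryAt P R z)) -
    empMean (P.size t) T (q (queryAt P R z))| - P.ζ
  e z := empMean (P.size t) T (q (queryAt P R z))
  measurable_c := (continuous_abs.measurable.comp ((measurable_empMean_queryAt P hq hR _ _).sub
    (measurable_empMean_queryAt P hq hR _ _))).sub_const _
  measurable_e := measurable_empMean_queryAt P hq hR _ _

omit [MeasurableSpace X] in
theorem abs_empMean_update_sub_le {f : X → ℝ} (hf : ∀ x, f x ∈ Icc (0 : ℝ) 1) (N : ℕ)
    (T : ℕ → X) (j : ℕ) (x : X) :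
    |empMean N T f - empMean N (Function.update T j x) f| ≤ 1 / N := by
  unfold empMean
  rw [← sub_div, abs_div, Nat.abs_cast, ← Finset.sum_sub_distrib]
  gcongr
  have h : ∀ k ∈ Finset.range N, k ≠ j → f (T k) - f (Function.update T j x k) = 0 := by
    intro k _ hk
    rw [Function.update_of_ne hk, sub_self]
  by_cases hj : j ∈ Finset.range N
  · rw [Finset.sum_eq_single_of_mem j hj h, Function.update_self, abs_le]
    have h1 := hf (T j)
    have h2 := hf x
    constructor <;> linarith [h1.1, h1.2, h2.1, h2.2]
  · rw [Finset.sum_eq_zero fun k hk => h k hk fun e => hj (e ▸ hk)]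
    simp

theorem roundStat_close (hq1 : ∀ θ x, q θ x ∈ Icc (0 : ℝ) 1) (T : ℕ → X) (j : ℕ) (x : X) :
    SparseGame.Stat.Close (1 / (P.size t : ℝ)) (roundStat P hq hR t S T)
      (roundStat P hq hR t S (Function.update T j x)) := by
  intro z
  have h := abs_empMean_update_sub_le (hq1 (queryAt P R z)) (P.size t) T j x
  refine ⟨le_trans ?_ h, h⟩
  simp only [roundStat]
  rw [sub_sub_sub_cancel_right]
  refine (abs_abs_sub_abs_le_abs_sub _ _).trans (le_of_eq ?_)
  rw [sub_sub_sub_cancel_left, abs_sub_comm]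

/-- The counters of the game, when the interaction is in state `s`. -/
def Counters (s : RoundState) (b k l : ℕ) : Prop :=
  (s.t < t → b = ⌊P.B t⌋₊ ∧ k = 0 ∧ l = 0) ∧
    (s.t = t → b + s.overfit = ⌊P.B t⌋₊ ∧ k = s.overfit ∧ l = s.answered)

variable {P t} in
theorem Counters.next_of_ne (hP : ∀ t, ∃ s, t ≤ s ∧ ¬ Halted P ⟨s, 0, 0⟩) {s : RoundState}
    {b k l : ℕ} (h : Counters P t s b k l) (ht : s.t ≠ t) (o : Bool) :
    Counters P t (nextState P s o) b k l := by
  unfold Counters nextState at *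
  rcases (settle_spec hP ⟨s.t, s.answered + 1, if o then s.overfit + 1 else s.overfit⟩).2
    with h' | ⟨h1, h2, h3⟩
  · rw [h']
    exact ⟨h.1, fun e => absurd e ht⟩
  · rw [h2, h3]
    dsimp only at h1
    constructor
    · intro h4
      exact h.1 (by omega)
    · intro h4
      obtain ⟨rfl, rfl, rfl⟩ := h.1 (by omega)
      simp

-- A round that has not halted satisfies overfit + 1 ≤ B_t, and the left side is an integer. Hence a
-- budget of ⌊B_t⌋ successes is never exhausted while the round is running, and capping the game at
-- it loses nothing.
variable {P t} in
theorem Counters.next_of_eq (hP : ∀ t, ∃ s, t ≤ s ∧ ¬ Halted P ⟨s, 0, 0⟩) {s : RoundState}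
    {b k l : ℕ} (h : Counters P t s b k l) (ht : s.t = t) (hs : ¬ Halted P s) :
    0 < b ∧ Counters P t (nextState P s true) (b - 1) (k + 1) (l + 1) ∧
      Counters P t (nextState P s false) b k (l + 1) := by
  obtain ⟨h1, h2, h3⟩ := h.2 ht
  have hb : s.overfit + 1 ≤ ⌊P.B t⌋₊ := by
    refine Nat.le_floor ?_
    have := (not_or.1 hs).1
    rw [ht] at this
    push_cast
    linarith
  refine ⟨by omega, ?_, ?_⟩
  all_goals
    unfold Counters nextState
    rcases (settle_spec hP ⟨s.t, s.answered + 1, _⟩).2 with h' | ⟨h4, -, -⟩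
    · rw [h']
      simp only [ht, lt_irrefl, false_imp_iff, true_and, true_imp_iff, if_true]
      simp
      omega
    · dsimp only at h4
      exact ⟨fun h5 => by omega, fun h5 => by omega⟩

-- In round `t` the budget is positive and the step of the game is the threshold test of the
-- mechanism, with matching noise indices. In any other round the reply does not read entry `t` of
-- the tape, so it can be computed from the frozen `tape`.
include hq hR in
theorem play_take (hP : ∀ t, ∃ s, t ≤ s ∧ ¬ Halted P ⟨s, 0, 0⟩) (hσ : 0 < P.σ t) (T : ℕ → X)
    (n : Noise) {y : ℕ → Bool × ℝ}
    (hy : y = replies P q R (Function.update tape t (S, T, n))) (m : ℕ) {i b k l : ℕ}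
    (h : Counters P t (replay P R y i).2 b k l) :
    (roundGame P hq hR tape t S).play (roundStat P hq hR t S T) n m b k l (Play.take y i) =
      Play.take y (i + m) := by
  classical
  set tp := Function.update tape t (S, T, n) with htp
  induction m generalizing i b k l with
  | zero => rfl
  | succ m ih =>
    have hrun : run P q R tp i = replay P R y i := by rw [run_eq_replay, hy]
    have hrep : replay P R (Play.take y i).2 (Play.take y i).1 = replay P R y i :=
      replay_congr P R fun j hj => if_pos hj
    have hst : stateAt P R (Play.take y i) = (replay P R y i).2 := by rw [stateAt, hrep]
    have hqu : queryAt P R (Play.take y i) = R i (replay P R y i).1 := by rw [queryAt, hrep]; rfl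
    have hyi : y i = (reply P tp (replay P R y i).2 (q (R i (replay P R y i).1))).swap := by
      conv_lhs => rw [hy]
      rw [replies, hrun]
    have hnh : ¬ Halted P (replay P R y i).2 := hrun ▸ run_not_halted hP i
    have hnext : ∀ o, (y i).1 = o →
        (replay P R y (i + 1)).2 = nextState P (replay P R y i).2 o := by
      rintro o rfl
      rfl
    rw [SparseGame.play, show i + (m + 1) = i + 1 + m by ring]
    by_cases ht : (replay P R y i).2.t = t
    · obtain ⟨hb, htop, hbot⟩ := h.next_of_eq hP ht hnh
      obtain ⟨-, hk, hl⟩ := h.2 ht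
      have hact : Play.take y i ∈ (roundGame P hq hR tape t S).act ∧ 0 < b := by
        refine ⟨?_, hb⟩
        change (stateAt P R (Play.take y i)).t = t
        rw [hst, ht]
      rw [if_pos hact]
      have hiff : n.2.1 l < ((roundStat P hq hR t S T).c (Play.take y i) -
            2 * (roundGame P hq hR tape t S).σ * n.1 k) / (4 * (roundGame P hq hR tape t S).σ) ↔
          |empMean (P.size t) S (q (R i (replay P R y i).1)) -
            empMean (P.size t) T (q (R i (replay P R y i).1))| >
            P.ζ + 2 * P.σ t * n.1 k + 4 * P.σ t * n.2.1 l := by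
        simp only [roundGame, roundStat, hqu]
        rw [lt_div_iff₀ (by positivity)]
        constructor <;> intro <;> linarith
      have htape : tp t = (S, T, n) := Function.update_self ..
      simp only [reply, ht, htape, RoundTape.S, RoundTape.T, RoundTape.rho, RoundTape.lam,
        RoundTape.xi, ← hk, ← hl, thresholdoutReply] at hyi
      split_ifs with hlt
      · rw [if_pos (hiff.1 hlt)] at hyi
        have : (roundGame P hq hR tape t S).top (Play.take y i,
            (roundStat P hq hR t S T).e (Play.take y i) +
              (roundGame P hq hR tape t S).σ * n.2.2 l) = Play.take y (i + 1) := by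
          rw [← Play.push_take, hyi]
          simp only [roundGame, roundStat, hqu, Prod.swap_prod_mk]
        rw [this]
        exact ih (hnext true (by rw [hyi]; rfl) ▸ htop)
      · rw [if_neg (hiff.not.1 hlt)] at hyi
        have : (roundGame P hq hR tape t S).bot (Play.take y i) = Play.take y (i + 1) := by
          rw [← Play.push_take, hyi]
          simp only [roundGame, hqu, Prod.swap_prod_mk]
        rw [this]
        exact ih (hnext false (by rw [hyi]; rfl) ▸ hbot)
    · have hact : ¬ (Play.take y i ∈ (roundGame P hq hR tape t S).act ∧ 0 < b) := by
        rintro ⟨h1, -⟩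
        change (stateAt P R (Play.take y i)).t = t at h1
        exact ht (hst ▸ h1)
      rw [if_neg hact]
      have : (roundGame P hq hR tape t S).idle (Play.take y i) = Play.take y (i + 1) := by
        rw [← Play.push_take, hyi]
        simp only [roundGame, hqu, hst]
        rw [reply, reply, htp, Function.update_of_ne ht]
      rw [this]
      exact ih (hnext _ rfl ▸ h.next_of_ne hP ht _)

include hq hR in
theorem play_eq_take_replies (hP : ∀ t, ∃ s, t ≤ s ∧ ¬ Halted P ⟨s, 0, 0⟩) (hσ : 0 < P.σ t)
    (T : ℕ → X) (n : Noise) (I : ℕ) :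
    (roundGame P hq hR tape t S).play (roundStat P hq hR t S T) n I ⌊P.B t⌋₊ 0 0
        (0, fun _ => (false, 0)) =
      Play.take (replies P q R (Function.update tape t (S, T, n))) I := by
  have h := play_take P hq hR tape t S hP hσ T n
    (y := replies P q R (Function.update tape t (S, T, n))) rfl I (i := 0) (b := ⌊P.B t⌋₊)
    (k := 0) (l := 0) ⟨fun _ => ⟨rfl, rfl, rfl⟩, fun _ => ⟨rfl, rfl, rfl⟩⟩
  simpa [Play.take] using h

end Round

/-! ### Bad queries and the reward for finding one -/

section Round

variable {X Θ : Type*} [MeasurableSpace X] (P : Params) (q : Θ → X → ℝ)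
  (R : ∀ i : ℕ, (Fin i → Record Θ) → Θ) (D : Measure X) (t : ℕ)

/-- According to the replies `y`, query `i` is posed in round `t` and its answer is inaccurate. -/
def Bad (y : ℕ → Bool × ℝ) (i : ℕ) : Prop :=
  (replay P R y i).2.t = t ∧ P.τ < |(y i).2 - ∫ x, q (R i (replay P R y i).1) x ∂D|

open Classical in
/-- Query `i`, or its complement if the answer is too small. -/
def gain (y : ℕ → Bool × ℝ) (i : ℕ) (x : X) : ENNReal :=
  ENNReal.ofReal (if ∫ x, q (R i (replay P R y i).1) x ∂D < (y i).2 then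
    q (R i (replay P R y i).1) x else 1 - q (R i (replay P R y i).1) x)

open Classical in
/-- The gain from the last bad query among the first `I`. -/
def payoff : ℕ → (ℕ → Bool × ℝ) → X → ENNReal
  | 0, _, _ => 0
  | I + 1, y, x => if Bad P q R D t y I then gain P q R D y I x else payoff I y x

variable {P q R D t}

theorem payoff_cases (I : ℕ) (y : ℕ → Bool × ℝ) :
    (∃ i < I, Bad P q R D t y i ∧ payoff P q R D t I y = gain P q R D y i) ∨
      ((∀ i < I, ¬ Bad P q R D t y i) ∧ payoff P q R D t I y = 0) := by
  induction I with
  | zero => exact Or.inr ⟨by simp, rfl⟩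
  | succ I ih =>
    by_cases h : Bad P q R D t y I
    · exact Or.inl ⟨I, Nat.lt_succ_self I, h, funext fun x => if_pos h⟩
    · have e : payoff P q R D t (I + 1) y = payoff P q R D t I y := funext fun x => if_neg h
      rw [e]
      rcases ih with ⟨i, hi, h'⟩ | ⟨h1, h2⟩
      · exact Or.inl ⟨i, by omega, h'⟩
      · refine Or.inr ⟨fun i hi => ?_, h2⟩
        rcases Nat.lt_succ_iff_lt_or_eq.1 hi with h3 | rfl
        · exact h1 i h3
        · exact h

theorem bad_congr {y y' : ℕ → Bool × ℝ} {i : ℕ} (h : ∀ j ≤ i, y j = y' j) :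
    Bad P q R D t y i ↔ Bad P q R D t y' i := by
  rw [Bad, Bad, replay_congr P R fun j hj => h j hj.le, h i le_rfl]

theorem payoff_congr {y y' : ℕ → Bool × ℝ} {I : ℕ} (h : ∀ j < I, y j = y' j) :
    payoff P q R D t I y = payoff P q R D t I y' := by
  induction I with
  | zero => rfl
  | succ I ih =>
    funext x
    rw [payoff, payoff, ih fun j hj => h j (by omega), gain, gain,
      replay_congr P R fun j hj => h j (by omega), h I (by omega)]
    have hb : Bad P q R D t y I ↔ Bad P q R D t y' I := bad_congr fun j hj => h j (by omega)
    by_cases hy : Bad P q R D t y I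
    · rw [if_pos hy, if_pos (hb.1 hy)]
    · rw [if_neg hy, if_neg (hb.not.1 hy)]

theorem gain_le_one (hq1 : ∀ θ x, q θ x ∈ Icc (0 : ℝ) 1) (y : ℕ → Bool × ℝ) (i : ℕ) (x : X) :
    gain P q R D y i x ≤ 1 := by
  rw [gain, ENNReal.ofReal_le_one]
  split_ifs
  · exact (hq1 _ x).2
  · linarith [(hq1 (R i (replay P R y i).1) x).1]

theorem payoff_le_one (hq1 : ∀ θ x, q θ x ∈ Icc (0 : ℝ) 1) (I : ℕ) (y : ℕ → Bool × ℝ) (x : X) :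
    payoff P q R D t I y x ≤ 1 := by
  rcases payoff_cases (P := P) (q := q) (R := R) (D := D) (t := t) I y with
    ⟨i, -, -, h⟩ | ⟨-, h⟩
  · rw [h]
    exact gain_le_one hq1 y i x
  · simp [h]

section Measurability

variable [MeasurableSpace Θ] [IsProbabilityMeasure D] (hq : Measurable (Function.uncurry q))
  (hR : ∀ i, Measurable (R i))

include hq in
theorem measurable_mean : Measurable fun θ => ∫ x, q θ x ∂D :=
  (hq.stronglyMeasurable.integral_prod_right (f := q)).measurable

omit [MeasurableSpace X] in
include hR in
theorem measurable_query_replay (i : ℕ) :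
    Measurable fun y : ℕ → Bool × ℝ => R i (replay P R y i).1 :=
  (hR i).comp (measurable_fst.comp (measurable_replay_const P hR i))

include hq hR

theorem measurable_mean_replay (i : ℕ) :
    Measurable fun y : ℕ → Bool × ℝ => ∫ x, q (R i (replay P R y i).1) x ∂D :=
  (measurable_mean hq).comp (measurable_query_replay hR i)

omit hR in
theorem measurableSet_bad_prod {U : Type*} [MeasurableSpace U]
    {R : ∀ i : ℕ, U → (Fin i → Record Θ) → Θ} (hR : ∀ i, Measurable (Function.uncurry (R i)))
    (i : ℕ) :
    MeasurableSet {p : U × (ℕ → Bool × ℝ) | Bad P q (fun i => R i p.1) D t p.2 i} := by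
  have h0 := measurable_replay P hR i
  have h1 : MeasurableSet {p : U × (ℕ → Bool × ℝ) |
      (replay P (fun i => R i p.1) p.2 i).2.t = t} :=
    (measurable_snd.comp h0) (MeasurableSet.of_discrete (s := {s : RoundState | s.t = t}))
  have h2 : Measurable fun p : U × (ℕ → Bool × ℝ) =>
      R i p.1 (replay P (fun i => R i p.1) p.2 i).1 :=
    (hR i).comp (measurable_fst.prodMk (measurable_fst.comp h0))
  have h3 : Measurable fun p : U × (ℕ → Bool × ℝ) => (p.2 i).2 :=
    measurable_snd.comp ((measurable_pi_apply i).comp measurable_snd)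
  exact h1.inter (measurableSet_lt measurable_const
    (continuous_abs.measurable.comp (h3.sub ((measurable_mean hq).comp h2))))

theorem measurableSet_bad (i : ℕ) : MeasurableSet {y | Bad P q R D t y i} :=
  (measurable_const (a := ())).prodMk measurable_id
    (measurableSet_bad_prod (D := D) (P := P) (t := t) hq
    (U := Unit) (R := fun i _ => R i) (fun i => (hR i).comp measurable_snd) i)

theorem measurable_gain (i : ℕ) :
    Measurable fun p : (ℕ → Bool × ℝ) × X => gain P q R D p.1 i p.2 := by
  classical
  have h : Measurable fun p : (ℕ → Bool × ℝ) × X => q (R i (replay P R p.1 i).1) p.2 :=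
    hq.comp (((measurable_query_replay hR i).comp measurable_fst).prodMk measurable_snd)
  refine ENNReal.measurable_ofReal.comp (Measurable.ite ?_ h (h.const_sub 1))
  exact measurableSet_lt ((measurable_mean_replay hq hR i).comp measurable_fst)
    (measurable_snd.comp ((measurable_pi_apply i).comp measurable_fst))

theorem measurable_payoff (I : ℕ) :
    Measurable fun p : (ℕ → Bool × ℝ) × X => payoff P q R D t I p.1 p.2 := by
  classical
  induction I with
  | zero => exact measurable_const
  | succ I ih =>
    exact Measurable.ite (measurable_fst (measurableSet_bad hq hR I)) (measurable_gain hq hR I) ih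

end Measurability

/-- The answer is more than τ away from the true mean but within 15τ/16 of the sample mean, so the
two means differ by at least τ/16, on the side indicated by the answer. Passing to the complement
when the answer is too small makes the difference positive. -/
theorem gain_gap [MeasurableSpace Θ] (hq : Measurable (Function.uncurry q))
    (hq1 : ∀ θ x, q θ x ∈ Icc (0 : ℝ) 1)
    [IsProbabilityMeasure D] {N : ℕ} (hN : 0 < N) (hτ : 0 < P.τ) {T : ℕ → X}
    {y : ℕ → Bool × ℝ} {i : ℕ} (hb : Bad P q R D t y i)
    (ha : |(y i).2 - empMean N T (q (R i (replay P R y i).1))| ≤ 15 * P.τ / 16) :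
    ENNReal.ofReal (P.τ / 16) + ∫⁻ x, gain P q R D y i x ∂D ≤
      (N : ENNReal)⁻¹ * ∑ j ∈ Finset.range N, gain P q R D y i (T j) := by
  classical
  set θ := R i (replay P R y i).1 with hθ
  have hqm : Measurable (q θ) := hq.comp (measurable_const.prodMk measurable_id)
  have hqi : Integrable (q θ) D := by
    refine Integrable.of_bound hqm.aestronglyMeasurable 1 (Filter.Eventually.of_forall fun x => ?_)
    rw [Real.norm_eq_abs, abs_of_nonneg (hq1 θ x).1]
    exact (hq1 θ x).2
  have hN' : (0 : ℝ) < N := Nat.cast_pos.2 hN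
  have key : ∀ g : X → ℝ, (∀ x, 0 ≤ g x) → Integrable g D →
      P.τ / 16 + ∫ x, g x ∂D ≤ empMean N T g →
      ENNReal.ofReal (P.τ / 16) + ∫⁻ x, ENNReal.ofReal (g x) ∂D ≤
        (N : ENNReal)⁻¹ * ∑ j ∈ Finset.range N, ENNReal.ofReal (g (T j)) := by
    intro g hg hgi h
    rw [← ofReal_integral_eq_lintegral_ofReal hgi (Filter.Eventually.of_forall hg),
      ← ENNReal.ofReal_add (by positivity) (integral_nonneg hg),
      ← ENNReal.ofReal_sum_of_nonneg fun j _ => hg (T j), ← ENNReal.ofReal_natCast,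
      ← ENNReal.ofReal_inv_of_pos hN', ← ENNReal.ofReal_mul (by positivity)]
    refine ENNReal.ofReal_le_ofReal (h.trans (le_of_eq ?_))
    rw [empMean, div_eq_inv_mul]
  obtain ⟨-, hb⟩ := hb
  rw [← hθ] at hb
  have ha' := abs_le.1 ha
  by_cases hlt : ∫ x, q θ x ∂D < (y i).2
  · simp only [gain, ← hθ, if_pos hlt]
    refine key (q θ) (fun x => (hq1 θ x).1) hqi ?_
    rw [abs_of_pos (sub_pos.2 hlt)] at hb
    linarith [ha'.2]
  · simp only [gain, ← hθ, if_neg hlt]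
    refine key (fun x => 1 - q θ x) (fun x => by linarith [(hq1 θ x).2])
      ((integrable_const _).sub hqi) ?_
    rw [integral_sub (integrable_const _) hqi]
    have : empMean N T (fun x => 1 - q θ x) = 1 - empMean N T (q θ) := by
      simp only [empMean, Finset.sum_sub_distrib, Finset.sum_const, Finset.card_range,
        nsmul_eq_mul, mul_one, sub_div]
      rw [div_self hN'.ne']
    rw [this]
    rw [abs_of_nonpos (by linarith)] at hb
    simp
    linarith [ha'.1]

end Round

/-! ### Accuracy on the empirical sample -/

/-- The noises of a round are moderate. -/
def moderateNoise (M : ℕ) (w : ℝ) : Set Noise :=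
  {n | ∀ k < M, |n.1 k| ≤ w ∧ |n.2.1 k| ≤ w ∧ |n.2.2 k| ≤ w}

theorem noiseLaw_compl_moderateNoise_le (M : ℕ) {w : ℝ} (hw : 0 ≤ w) :
    noiseLaw (moderateNoise M w)ᶜ ≤ 3 * M * ENNReal.ofReal (Real.exp (-w)) := by
  have hsub : (moderateNoise M w)ᶜ ⊆ ⋃ k ∈ Finset.range M, ({n : Noise | w < |n.1 k|} ∪
      ({n : Noise | w < |n.2.1 k|} ∪ {n : Noise | w < |n.2.2 k|})) := by
    intro n hn
    simp only [moderateNoise, mem_compl_iff, mem_ofPred_eq, not_forall] at hn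
    obtain ⟨k, hk, h⟩ := hn
    simp only [mem_iUnion, Finset.mem_range]
    refine ⟨k, hk, ?_⟩
    by_contra h'
    simp only [mem_union, mem_ofPred_eq, not_or, not_lt] at h'
    exact h h'
  have hs : MeasurableSet {z : ℝ | w < |z|} :=
    measurableSet_lt measurable_const continuous_abs.measurable
  have hev : ∀ k, MeasurePreserving (fun x : ℕ → ℝ => x k) laplaceTape laplace := fun k =>
    measurePreserving_eval_infinitePi (fun _ : ℕ => laplace) k
  have h1 : ∀ k, noiseLaw {n : Noise | w < |n.1 k|} ≤ ENNReal.ofReal (Real.exp (-w)) := fun k => by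
    have := ((hev k).comp (measurePreserving_fst (μ := laplaceTape)
      (ν := laplaceTape.prod laplaceTape))).measure_preimage hs.nullMeasurableSet
    exact this.trans_le (laplace_abs_gt hw)
  have h2 : ∀ k, noiseLaw {n : Noise | w < |n.2.1 k|} ≤ ENNReal.ofReal (Real.exp (-w)) :=
    fun k => by
    have := ((hev k).comp ((measurePreserving_fst (μ := laplaceTape) (ν := laplaceTape)).comp
      (measurePreserving_snd (μ := laplaceTape)
        (ν := laplaceTape.prod laplaceTape)))).measure_preimage hs.nullMeasurableSet
    exact this.trans_le (laplace_abs_gt hw)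
  have h3 : ∀ k, noiseLaw {n : Noise | w < |n.2.2 k|} ≤ ENNReal.ofReal (Real.exp (-w)) :=
    fun k => by
    have := ((hev k).comp ((measurePreserving_snd (μ := laplaceTape) (ν := laplaceTape)).comp
      (measurePreserving_snd (μ := laplaceTape)
        (ν := laplaceTape.prod laplaceTape)))).measure_preimage hs.nullMeasurableSet
    exact this.trans_le (laplace_abs_gt hw)
  refine (measure_mono hsub).trans ((measure_biUnion_finset_le _ _).trans ?_)
  calc ∑ k ∈ Finset.range M, noiseLaw ({n : Noise | w < |n.1 k|} ∪
        ({n : Noise | w < |n.2.1 k|} ∪ {n : Noise | w < |n.2.2 k|}))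
      ≤ ∑ _k ∈ Finset.range M, 3 * ENNReal.ofReal (Real.exp (-w)) := by
        refine Finset.sum_le_sum fun k _ => ?_
        refine (measure_union_le _ _).trans ((add_le_add (h1 k)
          ((measure_union_le _ _).trans (add_le_add (h2 k) (h3 k)))).trans (le_of_eq ?_))
        ring
    _ = 3 * M * ENNReal.ofReal (Real.exp (-w)) := by
        rw [Finset.sum_const, Finset.card_range, nsmul_eq_mul]
        ring

theorem measurableSet_moderateNoise (M : ℕ) (w : ℝ) : MeasurableSet (moderateNoise M w) := by
  have : moderateNoise M w = ⋂ k, ⋂ (_ : k < M), {n | |n.1 k| ≤ w ∧ |n.2.1 k| ≤ w ∧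
      |n.2.2 k| ≤ w} := by
    ext n
    simp [moderateNoise]
  rw [this]
  refine MeasurableSet.iInter fun k => MeasurableSet.iInter fun _ => ?_
  have h1 : Measurable fun n : Noise => n.1 k := by fun_prop
  have h2 : Measurable fun n : Noise => n.2.1 k := by fun_prop
  have h3 : Measurable fun n : Noise => n.2.2 k := by fun_prop
  exact (measurableSet_le (continuous_abs.measurable.comp h1) measurable_const).inter
    ((measurableSet_le (continuous_abs.measurable.comp h2) measurable_const).inter
      (measurableSet_le (continuous_abs.measurable.comp h3) measurable_const))

/-- Each standard noise contributes at most τ/32 after scaling by σ. Under ⊥ the failed test gives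
|E_S - E_T| ≤ 3τ/4 + 2τ/32 + 4τ/32 = 15τ/16; under ⊤ the error is only the answer noise. -/
theorem abs_replies_sub_empMean_le {X Θ : Type*} {P : Params} {q : Θ → X → ℝ}
    {R : ∀ i : ℕ, (Fin i → Record Θ) → Θ} (tape : ℕ → RoundTape X) {t : ℕ} (S T : ℕ → X)
    {n : Noise} (hP : ∀ t, ∃ s, t ≤ s ∧ ¬ Halted P ⟨s, 0, 0⟩) (hσ : 0 < P.σ t) (hτ : 0 < P.τ)
    {w : ℝ} (hw : P.σ t * w = P.τ / 32) (hn : n ∈ moderateNoise ⌊P.M t⌋₊ w)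
    {y : ℕ → Bool × ℝ} (hy : y = replies P q R (Function.update tape t (S, T, n))) {i : ℕ}
    (ht : (replay P R y i).2.t = t) :
    |(y i).2 - empMean (P.size t) T (q (R i (replay P R y i).1))| ≤ 15 * P.τ / 16 := by
  set tp := Function.update tape t (S, T, n) with htp
  have hrun : run P q R tp i = replay P R y i := by rw [run_eq_replay, hy]
  have hyi : y i = (reply P tp (replay P R y i).2 (q (R i (replay P R y i).1))).swap := by
    conv_lhs => rw [hy]
    rw [replies, hrun]
  have hnh : ¬ Halted P (replay P R y i).2 := hrun ▸ run_not_halted hP i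
  have hle : (replay P R y i).2.overfit ≤ (replay P R y i).2.answered := hrun ▸ run_overfit_le hP i
  have hans : (replay P R y i).2.answered < ⌊P.M t⌋₊ := by
    refine Nat.le_floor ?_
    have := (not_or.1 hnh).2
    rw [ht] at this
    push_cast
    linarith
  have htape : tp t = (S, T, n) := Function.update_self ..
  simp only [reply, ht, htape, RoundTape.S, RoundTape.T, RoundTape.rho, RoundTape.lam,
    RoundTape.xi, thresholdoutReply] at hyi
  have hrho := (hn _ (hle.trans_lt hans)).1
  obtain ⟨-, hlam, hxi⟩ := hn _ hans
  have bound : ∀ z : ℝ, |z| ≤ w → P.σ t * |z| ≤ P.τ / 32 := fun z hz =>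
    hw ▸ mul_le_mul_of_nonneg_left hz hσ.le
  split_ifs at hyi with h
  · rw [hyi]
    simp only [Prod.swap_prod_mk, add_sub_cancel_left, abs_mul, abs_of_pos hσ]
    linarith [bound _ hxi]
  · rw [hyi]
    simp only [Prod.swap_prod_mk]
    have h1 := (mul_le_mul_of_nonneg_left (le_abs_self _) hσ.le).trans (bound _ hrho)
    have h2 := (mul_le_mul_of_nonneg_left (le_abs_self _) hσ.le).trans (bound _ hlam)
    have h3 : P.ζ = 3 * P.τ / 4 := rfl
    linarith [not_lt.1 h]

/-! ### The failure probability of one round -/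

/-- If the law of a reward changes little when entry `j` of the sample is replaced, then entry `j`
of the sample may be exchanged for a fresh point. -/
theorem lintegral_self_le_of_update {X Y : Type*} [MeasurableSpace X] [MeasurableSpace Y]
    (D : Measure X) [IsProbabilityMeasure D] (ν : Measure Y) [IsProbabilityMeasure ν]
    {h : (ℕ → X) → Y → X → ENNReal}
    (hh : Measurable fun p : ((ℕ → X) × X) × Y => h p.1.1 p.2 p.1.2) {c δ : ENNReal} (j : ℕ)
    (hle : ∀ T x' x, ∫⁻ n, h T n x ∂ν ≤ c * ∫⁻ n, h (Function.update T j x') n x ∂ν + δ) :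
    ∫⁻ T, ∫⁻ n, h T n (T j) ∂ν ∂Measure.infinitePi (fun _ : ℕ => D) ≤
      c * ∫⁻ T, ∫⁻ x, ∫⁻ n, h T n x ∂ν ∂D ∂Measure.infinitePi (fun _ : ℕ => D) + δ := by
  set H : (ℕ → X) → X → ENNReal := fun T x => ∫⁻ n, h T n x ∂ν with hH
  have hHm : Measurable (Function.uncurry H) := hh.lintegral_prod_right'
  have hpt : ∀ T : ℕ → X, H T (T j) ≤
      c * ∫⁻ x, H (Function.update T j x) (T j) ∂D + δ := by
    intro T
    have hm : Measurable fun x => H (Function.update T j x) (T j) :=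
      hHm.comp ((measurable_update T).prodMk measurable_const)
    calc H T (T j) = ∫⁻ _, H T (T j) ∂D := by simp
      _ ≤ ∫⁻ x, (c * H (Function.update T j x) (T j) + δ) ∂D :=
        lintegral_mono fun x => hle T x (T j)
      _ = _ := by
        rw [lintegral_add_right _ measurable_const, lintegral_const_mul _ hm]
        simp
  have hm2 : Measurable fun T : ℕ → X => ∫⁻ x, H (Function.update T j x) (T j) ∂D := by
    refine Measurable.lintegral_prod_right' (f := fun p : (ℕ → X) × X =>
      H (Function.update p.1 j p.2) (p.1 j)) ?_
    exact hHm.comp ((measurable_update' (a := j)).prodMk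
      ((measurable_pi_apply j).comp measurable_fst))
  refine (lintegral_mono hpt).trans ?_
  rw [lintegral_add_right _ measurable_const, lintegral_const_mul _ hm2,
    lintegral_infinitePi_swap D j hHm, lintegral_const, measure_univ, mul_one]

section Round

variable {X Θ : Type*} [MeasurableSpace X] [MeasurableSpace Θ] {P : Params} {q : Θ → X → ℝ}
  (hq : Measurable (Function.uncurry q)) (hq1 : ∀ θ x, q θ x ∈ Icc (0 : ℝ) 1)
  {R : ∀ i : ℕ, (Fin i → Record Θ) → Θ} (hR : ∀ i, Measurable (R i))
  (D : Measure X) [IsProbabilityMeasure D] (tape : ℕ → RoundTape X) {t : ℕ} (S : ℕ → X)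
  (hP : ∀ t, ∃ s, t ≤ s ∧ ¬ Halted P ⟨s, 0, 0⟩) (hσ : 0 < P.σ t) (hN : 0 < P.size t)

variable (P q R t) in
/-- The replies as a function of the hidden data of round `t`. -/
def roundReplies (T : ℕ → X) (n : Noise) : ℕ → Bool × ℝ :=
  replies P q R (Function.update tape t (S, T, n))

include hq hR in
theorem measurable_roundReplies {Y : Type*} [MeasurableSpace Y] {f : Y → ℕ → X} {g : Y → Noise}
    (hf : Measurable f) (hg : Measurable g) :
    Measurable fun p => roundReplies P q R tape t S (f p) (g p) := by
  have h' : Measurable fun p => Function.update tape t (S, f p, g p) :=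
    (measurable_update tape).comp (measurable_const.prodMk (hf.prodMk hg))
  have h := (measurable_replies (U := Unit) P hq (R := fun i _ => R i)
    fun i => (hR i).comp measurable_snd).comp ((measurable_const (a := ())).prodMk h')
  simp only [Function.comp_def] at h
  unfold roundReplies
  exact h

include hq hR in
theorem measurable_payoff_comp {Y : Type*} [MeasurableSpace Y] {f : Y → ℕ → Bool × ℝ} {g : Y → X}
    (hf : Measurable f) (hg : Measurable g) (I : ℕ) :
    Measurable fun p => payoff P q R D t I (f p) (g p) :=
  (measurable_payoff hq hR I).comp (hf.prodMk hg)

include hq hq1 hR hP hσ hN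

/-- For a fixed point `x` the payoff is a [0,1]-valued function of the transcript, hence an
admissible reward for the private game. -/
theorem lintegral_payoff_le {α : ℝ} (hα : 1 < α) (ε : ℝ) (I : ℕ) (T : ℕ → X) (j : ℕ)
    (x' x : X) :
    ∫⁻ n, payoff P q R D t I (roundReplies P q R tape t S T n) x ∂noiseLaw ≤
      ENNReal.ofReal (Real.exp ε) * ∫⁻ n, payoff P q R D t I
        (roundReplies P q R tape t S (Function.update T j x') n) x ∂noiseLaw +
      ENNReal.ofReal (Real.exp (⌊P.B t⌋₊ * ((α - 1 / 2) ^ 2 *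
        (2 * (1 / P.size t) / P.σ t) ^ 2 / 2) - (α - 1) * ε)) := by
  have hN' : (0 : ℝ) < P.size t := Nat.cast_pos.2 hN
  have h := (roundGame P hq hR tape t S).lintegral_play_le hσ
    (roundStat_close P hq hR t S hq1 T j x') (by positivity) hα
    (f := fun z => payoff P q R D t I z.2 x)
    ((measurable_payoff hq hR I).comp (measurable_snd.prodMk measurable_const))
    (fun z => payoff_le_one hq1 I z.2 x) ⌊P.B t⌋₊ I 0 0 (0, fun _ => (false, 0)) ε
  simp only [play_eq_take_replies P hq hR tape t S hP hσ] at h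
  have e : ∀ y : ℕ → Bool × ℝ, payoff P q R D t I (Play.take y I).2 x =
      payoff P q R D t I y x := fun y =>
    congrFun (payoff_congr fun j hj => if_pos hj) x
  simp only [e] at h
  exact h

theorem lintegral_payoff_self_le {α : ℝ} (hα : 1 < α) (ε : ℝ) (I j : ℕ) :
    ∫⁻ T, ∫⁻ n, payoff P q R D t I (roundReplies P q R tape t S T n) (T j) ∂noiseLaw
        ∂Measure.infinitePi (fun _ : ℕ => D) ≤
      ENNReal.ofReal (Real.exp ε) * ∫⁻ T, ∫⁻ x, ∫⁻ n, payoff P q R D t I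
        (roundReplies P q R tape t S T n) x ∂noiseLaw ∂D ∂Measure.infinitePi (fun _ : ℕ => D) +
      ENNReal.ofReal (Real.exp (⌊P.B t⌋₊ * ((α - 1 / 2) ^ 2 *
        (2 * (1 / P.size t) / P.σ t) ^ 2 / 2) - (α - 1) * ε)) := by
  have hm : Measurable fun p : ((ℕ → X) × X) × Noise =>
      roundReplies P q R tape t S p.1.1 p.2 :=
    measurable_roundReplies hq hR tape S (f := fun p : ((ℕ → X) × X) × Noise => p.1.1)
      (g := fun p => p.2) (measurable_fst.comp measurable_fst) measurable_snd
  have hle := lintegral_payoff_le hq hq1 hR D tape S hP hσ hN hα ε I (j := j)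
  generalize roundReplies P q R tape t S = Y at hm hle ⊢
  exact lintegral_self_le_of_update D noiseLaw (h := fun T n => payoff P q R D t I (Y T n))
    (measurable_payoff_comp hq hR D hm (measurable_snd.comp measurable_fst) I) j hle

/-- The probability that an answer of round `t` is inaccurate, weighted by the gap which such an
answer makes between the sample and the population, up to the reward `w` on the population. -/
theorem measure_bad_round_le (hτ : 0 < P.τ) (hτ1 : P.τ < 1) {α : ℝ} (hα : 1 < α) (ε : ℝ) {w : ℝ}
    (hw : P.σ t * w = P.τ / 32) (I : ℕ) :
    ∃ W : ENNReal,
      W ≤ ((Measure.infinitePi fun _ : ℕ => D).prod noiseLaw)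
        {p | ∃ i < I, Bad P q R D t (roundReplies P q R tape t S p.1 p.2) i} ∧
      ENNReal.ofReal (P.τ / 16) * ((Measure.infinitePi fun _ : ℕ => D).prod noiseLaw)
        {p | ∃ i < I, Bad P q R D t (roundReplies P q R tape t S p.1 p.2) i} + W ≤
      ENNReal.ofReal (Real.exp ε) * W +
      ENNReal.ofReal (Real.exp (⌊P.B t⌋₊ * ((α - 1 / 2) ^ 2 *
        (2 * (1 / P.size t) / P.σ t) ^ 2 / 2) - (α - 1) * ε)) +
      2 * noiseLaw (moderateNoise ⌊P.M t⌋₊ w)ᶜ := by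
  set δ := ENNReal.ofReal (Real.exp (⌊P.B t⌋₊ * ((α - 1 / 2) ^ 2 *
        (2 * (1 / P.size t) / P.σ t) ^ 2 / 2) - (α - 1) * ε)) with hδ
  set μ := Measure.infinitePi fun _ : ℕ => D with hμ
  set Y := roundReplies P q R tape t S with hY
  set N := P.size t with hNdef
  set A := moderateNoise ⌊P.M t⌋₊ w with hA
  have hYm : Measurable fun p : (ℕ → X) × Noise => Y p.1 p.2 :=
    measurable_roundReplies hq hR tape S measurable_fst measurable_snd
  have hacc : ∀ T n, n ∈ A → ∀ i, (replay P R (Y T n) i).2.t = t →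
      |(Y T n i).2 - empMean N T (q (R i (replay P R (Y T n) i).1))| ≤ 15 * P.τ / 16 :=
    fun T n hn i ht => abs_replies_sub_empMean_le tape S T hP hσ hτ hw hn rfl ht
  have hself := lintegral_payoff_self_le hq hq1 hR D tape S hP hσ hN hα ε I
  rw [← hY, ← hδ, ← hμ] at hself
  clear_value Y
  set F : Set ((ℕ → X) × Noise) := {p | ∃ i < I, Bad P q R D t (Y p.1 p.2) i} with hF
  have hFm : MeasurableSet F := by
    have : F = ⋃ i ∈ Finset.range I, (fun p : (ℕ → X) × Noise => Y p.1 p.2) ⁻¹'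
        {y | Bad P q R D t y i} := by
      ext p
      simp [hF]
    rw [this]
    exact Finset.measurableSet_biUnion _ fun i _ => hYm (measurableSet_bad hq hR i)
  have hpx : Measurable fun r : ((ℕ → X) × Noise) × X => payoff P q R D t I (Y r.1.1 r.1.2) r.2 :=
    measurable_payoff_comp hq hR D (hYm.comp measurable_fst) measurable_snd I
  have hpj : ∀ j, Measurable fun p : (ℕ → X) × Noise => payoff P q R D t I (Y p.1 p.2) (p.1 j) :=
    fun j => measurable_payoff_comp hq hR D hYm ((measurable_pi_apply j).comp measurable_fst) I
  -- The expected payoff at a point independent of the sample; it vanishes off `F`, whence `W ≤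
  -- P(F)`.
  set W := ∫⁻ p, ∫⁻ x, payoff P q R D t I (Y p.1 p.2) x ∂D ∂μ.prod noiseLaw with hW
  have hle1 : ∀ p : (ℕ → X) × Noise, ∫⁻ x, payoff P q R D t I (Y p.1 p.2) x ∂D ≤ 1 := fun p =>
    (lintegral_mono fun x => payoff_le_one hq1 I _ x).trans (by simp)
  refine ⟨W, ?_, ?_⟩
  · rw [← lintegral_indicator_one hFm]
    refine lintegral_mono fun p => ?_
    by_cases hp : p ∈ F
    · rw [indicator_of_mem hp]
      exact hle1 p
    · rw [indicator_of_notMem hp]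
      rcases payoff_cases (P := P) (q := q) (R := R) (D := D) (t := t) I (Y p.1 p.2) with
        ⟨i, hi, hb, -⟩ | ⟨-, h⟩
      · exact absurd ⟨i, hi, hb⟩ hp
      · simp [h]
  -- With moderate noise this is `gain_gap`; otherwise both terms on the left are at most 1 and the
  -- indicator pays 2.
  have hpoint : ∀ p : (ℕ → X) × Noise,
      F.indicator (fun _ => ENNReal.ofReal (P.τ / 16)) p +
        ∫⁻ x, payoff P q R D t I (Y p.1 p.2) x ∂D ≤
      (N : ENNReal)⁻¹ * ∑ j ∈ Finset.range N, payoff P q R D t I (Y p.1 p.2) (p.1 j) +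
        (Prod.snd ⁻¹' Aᶜ : Set ((ℕ → X) × Noise)).indicator (fun _ => 2) p := by
    intro p
    rcases payoff_cases (P := P) (q := q) (R := R) (D := D) (t := t) I (Y p.1 p.2) with
        ⟨i, hi, hb, h⟩ | ⟨hb, h⟩
    · by_cases hp : p.2 ∈ A
      · rw [indicator_of_mem (show p ∈ F from ⟨i, hi, hb⟩), h]
        refine le_add_right (gain_gap hq hq1 hN hτ hb ?_)
        exact hacc p.1 p.2 hp i hb.1
      · rw [indicator_of_mem (show p ∈ (Prod.snd ⁻¹' Aᶜ : Set ((ℕ → X) × Noise)) from hp)]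
        refine le_add_left ?_
        rw [← one_add_one_eq_two]
        refine add_le_add ?_ (hle1 p)
        refine (indicator_le_self _ _ _).trans ?_
        rw [ENNReal.ofReal_le_one]
        linarith
    · have hp : p ∉ F := fun ⟨i, hi, h'⟩ => hb i hi h'
      rw [indicator_of_notMem hp]
      simp [h]
  have hint := lintegral_mono (μ := μ.prod noiseLaw) hpoint
  rw [lintegral_add_left (measurable_const.indicator hFm), lintegral_indicator_const hFm,
    lintegral_add_left ((Finset.measurable_sum _ fun j _ => hpj j).const_mul _),
    lintegral_const_mul _ (Finset.measurable_sum _ fun j _ => hpj j),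
    lintegral_finsetSum _ fun j _ => hpj j,
    lintegral_indicator_const (measurable_snd (measurableSet_moderateNoise _ _).compl)] at hint
  have hAc : (μ.prod noiseLaw) (Prod.snd ⁻¹' Aᶜ) = noiseLaw Aᶜ :=
    (measurePreserving_snd (μ := μ) (ν := noiseLaw)).measure_preimage
      (measurableSet_moderateNoise _ _).compl.nullMeasurableSet
  rw [hAc] at hint
  refine hint.trans (add_le_add_left ?_ _)
  have hWeq : W = ∫⁻ T, ∫⁻ x, ∫⁻ n, payoff P q R D t I (Y T n) x ∂noiseLaw ∂D ∂μ := by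
    rw [hW, lintegral_prod _ (hpx.lintegral_prod_right').aemeasurable]
    refine lintegral_congr fun T => ?_
    rw [lintegral_lintegral_swap]
    exact (hpx.comp ((measurable_const.prodMk measurable_fst).prodMk
      measurable_snd)).aemeasurable
  have hj : ∀ j, ∫⁻ p, payoff P q R D t I (Y p.1 p.2) (p.1 j) ∂μ.prod noiseLaw ≤
      ENNReal.ofReal (Real.exp ε) * W + δ := fun j => by
    rw [lintegral_prod _ (hpj j).aemeasurable, hWeq]
    exact hself j
  -- The privacy bound is the same for every sample point, so averaging over `j` preserves it.
  calc (N : ENNReal)⁻¹ * ∑ j ∈ Finset.range N,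
        ∫⁻ p, payoff P q R D t I (Y p.1 p.2) (p.1 j) ∂μ.prod noiseLaw
      ≤ (N : ENNReal)⁻¹ * ∑ _j ∈ Finset.range N, (ENNReal.ofReal (Real.exp ε) * W + δ) := by
        gcongr with j _
        exact hj j
    _ = ENNReal.ofReal (Real.exp ε) * W + δ := by
        rw [Finset.sum_const, Finset.card_range, nsmul_eq_mul, ← mul_assoc,
          ENNReal.inv_mul_cancel (Nat.cast_ne_zero.2 hN.ne') (ENNReal.natCast_ne_top N), one_mul]

end Round

/-! ### The parameters -/

namespace Params

variable {P : Params} (hτ : P.τ ∈ Ioo (0 : ℝ) 1) (hβ : P.β ∈ Ioo (0 : ℝ) 1)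
  (hp : P.p ∈ Ioo (0 : ℝ) 1) (hn : 1 ≤ P.n)

include hβ in
theorem failProb_pos (t : ℕ) : 0 < P.failProb t := by
  have : 1 < Real.exp 1 := Real.one_lt_exp_iff.2 one_pos
  exact mul_pos (div_pos (mul_pos (by linarith) hβ.1) (Real.exp_pos _)) (Real.exp_pos _)

theorem failProb_eq (t : ℕ) : P.failProb t = P.failProb 0 * Real.exp (-(t : ℝ)) := by
  simp [failProb]

include hβ in
theorem failProb_lt_one (t : ℕ) : P.failProb t < 1 := by
  have h1 : P.failProb 0 < 1 := by
    simp only [failProb, CharP.cast_eq_zero, neg_zero, Real.exp_zero, mul_one]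
    rw [div_lt_one (Real.exp_pos _)]
    have : 1 < Real.exp 1 := Real.one_lt_exp_iff.2 one_pos
    nlinarith [hβ.1, hβ.2]
  rw [failProb_eq]
  have h2 : Real.exp (-(t : ℝ)) ≤ 1 := Real.exp_le_one_iff.2 (by simp)
  nlinarith [failProb_pos hβ 0, Real.exp_pos (-(t : ℝ))]

theorem hasSum_failProb : HasSum P.failProb P.β := by
  have h1 : 1 < Real.exp 1 := Real.one_lt_exp_iff.2 one_pos
  have h := (hasSum_geometric_of_lt_one (Real.exp_pos (-1)).le
    (Real.exp_lt_one_iff.2 (by norm_num : (-1 : ℝ) < 0))).mul_left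
    ((Real.exp 1 - 1) * P.β / Real.exp 1)
  have e1 : (Real.exp 1 - 1) * P.β / Real.exp 1 * (1 - Real.exp (-1))⁻¹ = P.β := by
    have : Real.exp 1 - 1 ≠ 0 := by linarith
    rw [Real.exp_neg]
    field_simp
  rw [e1] at h
  refine h.congr_fun fun t => ?_
  rw [failProb, ← Real.exp_nat_mul]
  congr 2
  ring

include hn in
theorem one_le_N (t : ℕ) : 1 ≤ P.N t := by
  have : 1 ≤ Real.exp (t : ℝ) := Real.one_le_exp (Nat.cast_nonneg t)
  unfold N
  nlinarith

include hβ in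
theorem log_four_mul_M_div (t : ℕ) :
    Real.log (4 * P.M t / P.failProb t) = 2 * P.N t ^ P.p := by
  have := failProb_pos hβ t
  have e : 4 * P.M t / P.failProb t = Real.exp (2 * P.N t ^ P.p) := by
    unfold M
    field_simp
  rw [e, Real.log_exp]

include hβ in
theorem σ_eq (t : ℕ) : P.σ t = P.τ / (96 * P.N t ^ P.p) := by
  rw [σ, log_four_mul_M_div hβ]
  congr 1
  ring

include hτ hβ hn in
theorem σ_pos (t : ℕ) : 0 < P.σ t := by
  have := Real.rpow_pos_of_pos (one_pos.trans_le (one_le_N hn t)) P.p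
  rw [σ_eq hβ]
  have := hτ.1
  positivity

include hn in
theorem size_pos (t : ℕ) : 0 < P.size t :=
  Nat.ceil_pos.2 (one_pos.trans_le (one_le_N hn t))

/-- The logarithmic factor in `B_t`. -/
def logFactor (P : Params) (t : ℕ) : ℝ :=
  Real.log (1664 * Real.log (208 / P.τ) / (P.τ * P.failProb t))

include hτ in
theorem five_le_log : 5 ≤ Real.log (208 / P.τ) := by
  have h0 := hτ.1
  rw [Real.le_log_iff_exp_le (by positivity)]
  have h1 : Real.exp 5 ≤ 208 := by
    have : Real.exp 5 = Real.exp 1 ^ 5 := by rw [← Real.exp_nat_mul]; norm_num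
    rw [this]
    calc Real.exp 1 ^ 5 ≤ 2.7182818286 ^ 5 :=
          pow_le_pow_left₀ (Real.exp_pos _).le Real.exp_one_lt_d9.le 5
      _ ≤ 208 := by norm_num
  refine h1.trans ?_
  rw [le_div_iff₀ h0]
  linarith [hτ.2]

include hτ hβ in
theorem exp_neg_logFactor_le (t : ℕ) :
    Real.exp (-P.logFactor t) ≤ P.τ * P.failProb t / 8320 := by
  have h1 := five_le_log hτ
  have h2 := failProb_pos hβ t
  have h3 := hτ.1
  rw [logFactor, Real.exp_neg, Real.exp_log (by positivity), inv_div]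
  gcongr
  linarith

include hτ hβ in
theorem logFactor_eq (t : ℕ) : P.logFactor t = P.logFactor 0 + t := by
  have h1 := five_le_log hτ
  have h2 := failProb_pos hβ 0
  have h3 := hτ.1
  rw [logFactor, logFactor, failProb_eq t, ← mul_assoc, ← div_div, Real.log_div (by positivity)
    (Real.exp_pos _).ne', Real.log_exp]
  ring

include hτ hβ in
theorem one_le_logFactor (t : ℕ) : 1 ≤ P.logFactor t := by
  have h1 := exp_neg_logFactor_le hτ hβ t
  have h2 : P.τ * P.failProb t / 8320 ≤ Real.exp (-1) := by
    have h3 : P.τ * P.failProb t ≤ 1 :=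
      mul_le_one₀ hτ.2.le (failProb_pos hβ t).le (failProb_lt_one hβ t).le
    have h4 : (3 : ℝ)⁻¹ ≤ Real.exp (-1) := by
      rw [Real.exp_neg]
      exact inv_anti₀ (Real.exp_pos _) (Real.exp_one_lt_d9.le.trans (by norm_num))
    linarith
  linarith [Real.exp_le_exp.1 (h1.trans h2)]

theorem B_eq (t : ℕ) :
    P.B t = P.τ ^ 4 * P.N t ^ (2 - 2 * P.p) / (8 * 9984 ^ 2 * P.logFactor t) := rfl

include hn in
-- Quadratic growth in `t` suffices to beat log(1/β_t) and the logarithmic factor of `B`, both of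
-- which grow linearly.
theorem N_rpow_ge {c : ℝ} (hc : 0 < c) (t : ℕ) : (c * t) ^ 2 / 2 ≤ P.N t ^ c := by
  have h1 : (c * t) ^ 2 / 2 ≤ Real.exp (c * t) := by
    have := Real.quadratic_le_exp_of_nonneg (x := c * t) (by positivity)
    have h0 : 0 ≤ c * t := by positivity
    linarith
  refine h1.trans ?_
  rw [N, Real.mul_rpow (by linarith) (Real.exp_pos _).le, ← Real.exp_mul, mul_comm (t : ℝ) c]
  exact le_mul_of_one_le_left (Real.exp_pos _).le (Real.one_le_rpow hn hc.le)

include hτ hβ hp hn in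
theorem exists_not_halted (t : ℕ) : ∃ s, t ≤ s ∧ ¬ Halted P ⟨s, 0, 0⟩ := by
  set c := 2 - 2 * P.p with hc
  have hc0 : 0 < c := by linarith [hp.2]
  have hτ0 := hτ.1
  have hp0 := hp.1
  have hL0 := one_le_logFactor hτ hβ 0
  have hf0 := failProb_pos hβ 0
  -- `s ≥ K` ensures `B s ≥ 1`, once the logarithmic factor is at most 2s; `s ≥ J` ensures `M s ≥
  -- 1`.
  set K := 8 * 9984 ^ 2 * 4 / (P.τ ^ 4 * c ^ 2) with hK
  set J := (1 + Real.log (4 / P.failProb 0)) / P.p ^ 2 with hJ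
  obtain ⟨s, hs⟩ := exists_nat_ge (max (max (t : ℝ) (P.logFactor 0)) (max K J))
  have hs1 : (t : ℝ) ≤ s := (le_max_left _ _).trans ((le_max_left _ _).trans hs)
  have hs2 : P.logFactor 0 ≤ s := (le_max_right _ _).trans ((le_max_left _ _).trans hs)
  have hs3 : K ≤ s := (le_max_left _ _).trans ((le_max_right _ _).trans hs)
  have hs4 : J ≤ s := (le_max_right _ _).trans ((le_max_right _ _).trans hs)
  have hs0 : (1 : ℝ) ≤ s := hL0.trans hs2
  refine ⟨s, by exact_mod_cast hs1, ?_⟩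
  rw [Halted, not_or, not_lt, not_lt]
  simp only [CharP.cast_eq_zero, sub_zero, zero_add]
  constructor
  · rw [B_eq, ← hc, logFactor_eq hτ hβ, one_le_div (by positivity)]
    have h1 := N_rpow_ge hn hc0 s
    rw [hK, div_le_iff₀ (by positivity)] at hs3
    calc 8 * 9984 ^ 2 * (P.logFactor 0 + s) ≤ 8 * 9984 ^ 2 * (2 * (s : ℝ)) := by gcongr; linarith
      _ = (8 * 9984 ^ 2 * 4) * (s : ℝ) / 2 := by ring
      _ ≤ (s * (P.τ ^ 4 * c ^ 2)) * s / 2 := by nlinarith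
      _ = P.τ ^ 4 * ((c * s) ^ 2 / 2) := by ring
      _ ≤ P.τ ^ 4 * P.N s ^ c := by gcongr
  · have h1 := N_rpow_ge hn hp0 s
    have hlog : 0 ≤ Real.log (4 / P.failProb 0) := by
      refine Real.log_nonneg ?_
      rw [one_le_div hf0]
      linarith [failProb_lt_one hβ 0]
    rw [hJ, div_le_iff₀ (by positivity)] at hs4
    have h2 : s + Real.log (4 / P.failProb 0) ≤ 2 * P.N s ^ P.p := by
      nlinarith
    have h3 : Real.exp (s + Real.log (4 / P.failProb 0)) ≤ Real.exp (2 * P.N s ^ P.p) :=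
      Real.exp_le_exp.2 h2
    rw [Real.exp_add, Real.exp_log (by positivity)] at h3
    rw [M, failProb_eq]
    calc (1 : ℝ) = P.failProb 0 * Real.exp (-(s : ℝ)) / 4 *
          (Real.exp s * (4 / P.failProb 0)) := by
          rw [Real.exp_neg]
          field_simp
      _ ≤ _ := by gcongr

include hτ hβ hn in
/-- The privacy parameter `δ` of a round, for `ε = τ / 52`. -/
theorem privacy_delta_le (t : ℕ) :
    Real.exp (⌊P.B t⌋₊ * ((1 / 2 + 416 * P.logFactor t / P.τ - 1 / 2) ^ 2 *
        (2 * (1 / P.size t) / P.σ t) ^ 2 / 2) -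
          (1 / 2 + 416 * P.logFactor t / P.τ - 1) * (P.τ / 52)) ≤
      P.τ * P.failProb t / 8320 := by
  refine le_trans (Real.exp_le_exp.2 ?_) (exp_neg_logFactor_le hτ hβ t)
  have hτ0 := hτ.1
  have hL := one_le_logFactor hτ hβ t
  have hN1 := one_le_N hn t
  have hN0 : 0 < P.N t := one_pos.trans_le hN1
  set L := P.logFactor t with hLdef
  set N := P.N t with hNdef
  have hNp : 0 < N ^ P.p := Real.rpow_pos_of_pos hN0 _
  have hB0 : 0 ≤ P.B t := by
    rw [B_eq, ← hLdef, ← hNdef]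
    have := Real.rpow_pos_of_pos hN0 (2 - 2 * P.p)
    positivity
  have h1 : 2 * (1 / (P.size t : ℝ)) / P.σ t ≤ 192 * N ^ P.p / (P.τ * N) := by
    rw [σ_eq hβ, ← hNdef]
    have hs : N ≤ P.size t := Nat.le_ceil _
    calc 2 * (1 / (P.size t : ℝ)) / (P.τ / (96 * N ^ P.p))
        ≤ 2 * (1 / N) / (P.τ / (96 * N ^ P.p)) := by gcongr
      _ = 192 * N ^ P.p / (P.τ * N) := by
        field_simp
        norm_num
  have h1' : 0 ≤ 2 * (1 / (P.size t : ℝ)) / P.σ t :=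
    div_nonneg (by positivity) (σ_pos hτ hβ hn t).le
  have hpow : N ^ (2 - 2 * P.p) * (N ^ P.p) ^ 2 = N ^ 2 := by
    rw [← Real.rpow_natCast (N ^ P.p), ← Real.rpow_mul hN0.le, ← Real.rpow_add hN0,
      ← Real.rpow_natCast N]
    congr 1
    push_cast
    ring
  -- The exponent 2 - 2p in `B` makes all powers of `N` cancel; 9984 = 52 · 192 and 21632 = 8 · 52².
  have h2 : P.B t * (192 * N ^ P.p / (P.τ * N)) ^ 2 = P.τ ^ 2 / (21632 * L) := by
    rw [B_eq, ← hLdef, ← hNdef, div_pow, mul_pow, mul_pow, div_mul_div_comm,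
      div_eq_div_iff (by positivity) (by positivity)]
    linear_combination (P.τ ^ 4 * 192 ^ 2 * 21632 * L) * hpow
  have h3 : (⌊P.B t⌋₊ : ℝ) * (2 * (1 / (P.size t : ℝ)) / P.σ t) ^ 2 ≤
      P.τ ^ 2 / (21632 * L) := by
    rw [← h2]
    gcongr
    exact Nat.floor_le hB0
  have e1 : (⌊P.B t⌋₊ : ℝ) * ((1 / 2 + 416 * L / P.τ - 1 / 2) ^ 2 *
      (2 * (1 / (P.size t : ℝ)) / P.σ t) ^ 2 / 2) =
      (⌊P.B t⌋₊ * (2 * (1 / (P.size t : ℝ)) / P.σ t) ^ 2) * ((416 * L / P.τ) ^ 2 / 2) := by ring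
  have h4 : (⌊P.B t⌋₊ * (2 * (1 / (P.size t : ℝ)) / P.σ t) ^ 2) * ((416 * L / P.τ) ^ 2 / 2) ≤
      P.τ ^ 2 / (21632 * L) * ((416 * L / P.τ) ^ 2 / 2) := by gcongr
  -- The value α - 1/2 = 416 L/τ minimizes (α - 1/2)² τ²/(43264 L) - (α - 1) τ/52, leaving -4L +
  -- τ/104, which is at most -L as `L ≥ 1`.
  have e2 : P.τ ^ 2 / (21632 * L) * ((416 * L / P.τ) ^ 2 / 2) = 4 * L := by
    field_simp
    norm_num
  have e3 : (1 / 2 + 416 * L / P.τ - 1) * (P.τ / 52) = 8 * L - P.τ / 104 := by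
    field_simp
    ring
  rw [e1, e3]
  linarith [hτ.2]

end Params

/-! ### One round with the actual constants -/

/-- The bound on the failure probability of a round which differential privacy yields. -/
theorem le_half_of_stability {τ b x W η : ℝ} (hτ : 0 < τ) (hτ1 : τ < 1) (hb : 0 ≤ b)
    (hx : 0 ≤ x) (hWx : W ≤ x)
    (h : τ / 16 * x + W ≤ Real.exp (τ / 52) * W + τ * b / 8320 + 2 * η) (hη : 2 * η ≤ τ * b / 100) :
    x ≤ b / 2 := by
  have hexp : Real.exp (τ / 52) - 1 ≤ τ / 50 := by
    have h1 := Real.abs_exp_sub_one_sub_id_le (x := τ / 52)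
      (by rw [abs_of_pos (by positivity)]; linarith)
    have h2 := (abs_le.1 h1).2
    nlinarith
  have h0 : 0 ≤ Real.exp (τ / 52) - 1 := by
    linarith [Real.one_le_exp (x := τ / 52) (by positivity)]
  have h1 : (Real.exp (τ / 52) - 1) * W ≤ τ / 50 * x :=
    (mul_le_mul_of_nonneg_left hWx h0).trans (mul_le_mul_of_nonneg_right hexp hx)
  -- Here 17/400 = 1/16 - 1/50, and the error terms fit because 1/8320 + 1/100 ≤ 17/800.
  have h2 : τ * (x * (17 / 400)) ≤ τ * (b * (17 / 800)) := by
    have : 0 ≤ τ * b := by positivity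
    nlinarith
  have := le_of_mul_le_mul_left h2 hτ
  linarith

theorem measure_bad_round_le_half {X Θ : Type*} [MeasurableSpace X] [MeasurableSpace Θ]
    {P : Params} (hτ : P.τ ∈ Ioo (0 : ℝ) 1) (hβ : P.β ∈ Ioo (0 : ℝ) 1) (hp : P.p ∈ Ioo (0 : ℝ) 1)
    (hn : 1 ≤ P.n) (hn' : ∀ t, Real.log (150 / P.τ) ≤ P.N t ^ P.p) {q : Θ → X → ℝ}
    (hq : Measurable (Function.uncurry q)) (hq1 : ∀ θ x, q θ x ∈ Icc (0 : ℝ) 1)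
    {R : ∀ i : ℕ, (Fin i → Record Θ) → Θ} (hR : ∀ i, Measurable (R i)) (D : Measure X)
    [IsProbabilityMeasure D] (tape : ℕ → RoundTape X) (t : ℕ) (S : ℕ → X) (I : ℕ) :
    ((Measure.infinitePi fun _ : ℕ => D).prod noiseLaw)
        {p | ∃ i < I, Bad P q R D t (roundReplies P q R tape t S p.1 p.2) i} ≤
      ENNReal.ofReal (P.failProb t / 2) := by
  have hτ0 := hτ.1
  have hσ := Params.σ_pos hτ hβ hn t
  have hN0 : 0 < P.N t := one_pos.trans_le (Params.one_le_N hn t)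
  have hNp : 0 < P.N t ^ P.p := Real.rpow_pos_of_pos hN0 _
  have hL := Params.one_le_logFactor hτ hβ t
  have hb := Params.failProb_pos hβ t
  have hα : 1 < 1 / 2 + 416 * P.logFactor t / P.τ := by
    have : 1 ≤ 416 * P.logFactor t / P.τ := by
      rw [one_le_div hτ0]
      linarith [hτ.2]
    linarith
  have hw : P.σ t * (3 * P.N t ^ P.p) = P.τ / 32 := by
    rw [Params.σ_eq hβ]
    field_simp
    norm_num
  obtain ⟨W, hW1, hW2⟩ := measure_bad_round_le hq hq1 hR D tape S
    (Params.exists_not_halted hτ hβ hp hn) hσ (Params.size_pos hn t) hτ0 hτ.2 hα (P.τ / 52) hw I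
  set x := ((Measure.infinitePi fun _ : ℕ => D).prod noiseLaw)
    {p | ∃ i < I, Bad P q R D t (roundReplies P q R tape t S p.1 p.2) i} with hx
  have hxtop : x ≠ ⊤ := measure_ne_top _ _
  have hWtop : W ≠ ⊤ := ne_top_of_le_ne_top hxtop hW1
  have hM0 : 0 ≤ P.M t := by
    unfold Params.M
    positivity
  -- The union bound over `M` queries costs exp(2 N^p) and the tail at 3 N^p gains exp(-3 N^p). The
  -- remaining exp(-N^p) is at most τ/150; only here does the initial budget have to be large in
  -- terms of τ.
  have hη : noiseLaw (moderateNoise ⌊P.M t⌋₊ (3 * P.N t ^ P.p))ᶜ ≤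
      ENNReal.ofReal (P.τ * P.failProb t / 200) := by
    refine (noiseLaw_compl_moderateNoise_le _ (by positivity)).trans ?_
    rw [← ENNReal.ofReal_natCast, ← ENNReal.ofReal_ofNat, ← ENNReal.ofReal_mul (by norm_num),
      ← ENNReal.ofReal_mul (by positivity)]
    refine ENNReal.ofReal_le_ofReal ?_
    have h1 : Real.exp (-(P.N t ^ P.p)) ≤ P.τ / 150 := by
      have := Real.exp_le_exp.2 (neg_le_neg (hn' t))
      rwa [Real.exp_neg (Real.log _), Real.exp_log (by positivity), inv_div] at this
    calc 3 * (⌊P.M t⌋₊ : ℝ) * Real.exp (-(3 * P.N t ^ P.p))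
        ≤ 3 * P.M t * Real.exp (-(3 * P.N t ^ P.p)) := by
          gcongr
          exact Nat.floor_le hM0
      _ = 3 * (P.failProb t / 4) * (Real.exp (2 * P.N t ^ P.p) *
            Real.exp (-(3 * P.N t ^ P.p))) := by
          rw [Params.M]
          ring
      _ = 3 * (P.failProb t / 4) * Real.exp (-(P.N t ^ P.p)) := by
          rw [← Real.exp_add]
          congr 2
          ring
      _ ≤ 3 * (P.failProb t / 4) * (P.τ / 150) := by gcongr
      _ = P.τ * P.failProb t / 200 := by ring
  have hfin : x.toReal ≤ P.failProb t / 2 := by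
    refine le_half_of_stability hτ0 hτ.2 hb.le ENNReal.toReal_nonneg
      (ENNReal.toReal_mono hxtop hW1) (η := P.τ * P.failProb t / 200) ?_ (by linarith)
    have h := hW2.trans (add_le_add (add_le_add_right (ENNReal.ofReal_le_ofReal
      (Params.privacy_delta_le hτ hβ hn t)) _) (mul_le_mul_right hη 2))
    rw [← ENNReal.ofReal_toReal hxtop, ← ENNReal.ofReal_toReal hWtop, ← ENNReal.ofReal_ofNat,
      ← ENNReal.ofReal_mul (by positivity), ← ENNReal.ofReal_mul (by positivity),
      ← ENNReal.ofReal_mul (by positivity), ← ENNReal.ofReal_add (by positivity) (by positivity),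
      ← ENNReal.ofReal_add (by positivity) (by positivity),
      ← ENNReal.ofReal_add (by positivity) (by positivity)] at h
    exact (ENNReal.ofReal_le_ofReal_iff (by positivity)).1 h
  rw [← ENNReal.ofReal_toReal hxtop]
  exact ENNReal.ofReal_le_ofReal hfin

/-! ### All rounds together -/

section Total

variable {X Θ U : Type*} [MeasurableSpace X] [MeasurableSpace Θ] [MeasurableSpace U]

instance (D : Measure X) [IsProbabilityMeasure D] : IsProbabilityMeasure (roundLaw D) := by
  unfold roundLaw
  infer_instance

theorem lintegral_roundLaw (D : Measure X) [IsProbabilityMeasure D] {F : RoundTape X → ENNReal}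
    (hF : Measurable F) :
    ∫⁻ r, F r ∂roundLaw D = ∫⁻ S, ∫⁻ p, F (S, p)
      ∂(Measure.infinitePi fun _ : ℕ => D).prod noiseLaw ∂Measure.infinitePi fun _ : ℕ => D := by
  rw [roundLaw, lintegral_prod _ hF.aemeasurable]
  rfl

/-- Fubini: the tape of round `t` is resampled, and the hypothesis holds uniformly in the seed, the
other tapes and `S`, however the adaptive queries depend on them. -/
theorem interactionLaw_bad_le (D : Measure X) [IsProbabilityMeasure D] (ν : Measure U)
    [IsProbabilityMeasure ν] {P : Params} {q : Θ → X → ℝ} (hq : Measurable (Function.uncurry q))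
    {R : ∀ i : ℕ, U → (Fin i → Record Θ) → Θ} (hR : ∀ i, Measurable (Function.uncurry (R i)))
    {t I : ℕ} {c : ENNReal}
    (h : ∀ u tape S, ((Measure.infinitePi fun _ : ℕ => D).prod noiseLaw)
      {p | ∃ i < I, Bad P q (fun i => R i u) D t
        (roundReplies P q (fun i => R i u) tape t S p.1 p.2) i} ≤ c) :
    interactionLaw D ν {ω | ∃ i < I, Bad P q (fun i => R i ω.1) D t
      (replies P q (fun i => R i ω.1) ω.2) i} ≤ c := by
  set E := {ω : U × (ℕ → RoundTape X) | ∃ i < I, Bad P q (fun i => R i ω.1) D t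
      (replies P q (fun i => R i ω.1) ω.2) i} with hE
  have hEm : MeasurableSet E := by
    have : E = ⋃ i ∈ Finset.range I, (fun ω : U × (ℕ → RoundTape X) =>
        (ω.1, replies P q (fun i => R i ω.1) ω.2)) ⁻¹'
        {p | Bad P q (fun i => R i p.1) D t p.2 i} := by
      ext ω
      simp [hE]
    rw [this]
    exact Finset.measurableSet_biUnion _ fun i _ =>
      (measurable_fst.prodMk (measurable_replies P hq hR)) (measurableSet_bad_prod hq hR i)
  have hind : Measurable (E.indicator (1 : U × (ℕ → RoundTape X) → ENNReal)) :=
    measurable_one.indicator hEm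
  rw [← lintegral_indicator_one hEm, interactionLaw, lintegral_prod _ hind.aemeasurable]
  have hle : ∀ u tape, ∫⁻ r, E.indicator 1 (u, Function.update tape t r) ∂roundLaw D ≤ c := by
    intro u tape
    have hm : Measurable fun r => E.indicator (1 : U × (ℕ → RoundTape X) → ENNReal)
        (u, Function.update tape t r) :=
      hind.comp (measurable_const.prodMk (measurable_update tape))
    rw [lintegral_roundLaw D hm]
    have hS : ∀ S : ℕ → X, ∫⁻ p, E.indicator 1 (u, Function.update tape t (S, p))
        ∂(Measure.infinitePi fun _ : ℕ => D).prod noiseLaw ≤ c := by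
      intro S
      have hm' : Measurable fun p : (ℕ → X) × Noise => (u, Function.update tape t (S, p)) :=
        measurable_const.prodMk ((measurable_update tape).comp
          (measurable_const.prodMk measurable_id))
      have : (fun p : (ℕ → X) × Noise => E.indicator (1 : U × (ℕ → RoundTape X) → ENNReal)
          (u, Function.update tape t (S, p))) =
          ((fun p : (ℕ → X) × Noise => (u, Function.update tape t (S, p))) ⁻¹' E).indicator 1 := by
        funext p
        rfl
      rw [this, lintegral_indicator_one (hm' hEm)]
      exact h u tape S
    calc _ ≤ ∫⁻ _S : ℕ → X, c ∂Measure.infinitePi fun _ : ℕ => D := lintegral_mono hS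
      _ = c := by simp
  have hu : ∀ u, ∫⁻ tape, E.indicator 1 (u, tape) ∂Measure.infinitePi (fun _ : ℕ => roundLaw D) ≤
      c := by
    intro u
    rw [lintegral_infinitePi_update (fun _ : ℕ => roundLaw D) t
      (F := fun tape => E.indicator 1 (u, tape)) (hind.comp measurable_prodMk_left)]
    calc _ ≤ ∫⁻ _tape, c ∂Measure.infinitePi (fun _ : ℕ => roundLaw D) :=
          lintegral_mono (hle u)
      _ = c := by simp
  calc _ ≤ ∫⁻ _u, c ∂ν := lintegral_mono hu
    _ = c := by simp

end Total

end EverlastingTO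

end

/-! ### The union bound over all rounds -/

theorem mainTheorem9 (τ β p : ℝ) (hτ : τ ∈ Set.Ioo (0 : ℝ) 1) (hβ : β ∈ Set.Ioo (0 : ℝ) 1)
    (hp : p ∈ Set.Ioo (0 : ℝ) 1) :
    ∃ n₀ : ℝ, 0 < n₀ ∧ ∀ n : ℝ, n₀ ≤ n →
      ∀ (X : Type*) [MeasurableSpace X] (D : Measure X) [IsProbabilityMeasure D]
        (Θ : Type*) [MeasurableSpace Θ] (q : Θ → X → ℝ)
        (_ : Measurable (Function.uncurry q)) (_ : ∀ θ x, q θ x ∈ Set.Icc (0 : ℝ) 1)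
        (U : Type*) [MeasurableSpace U] (ν : Measure U) [IsProbabilityMeasure ν]
        (R : ∀ i : ℕ, U → (Fin i → EverlastingTO.Record Θ) → Θ)
        (_ : ∀ i, Measurable (Function.uncurry (R i))),
        EverlastingTO.interactionLaw D ν
            {ω | ∃ i : ℕ,
              τ < |EverlastingTO.answer ⟨τ, β, p, n⟩ q (fun i => R i ω.1) ω.2 i
                - ∫ x, EverlastingTO.query ⟨τ, β, p, n⟩ q (fun i => R i ω.1) ω.2 i x ∂D|}
          < ENNReal.ofReal β := by
  have hτ0 := hτ.1
  have hp0 := hp.1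
  have hlog : 0 < Real.log (150 / τ) := Real.log_pos (by rw [lt_div_iff₀ hτ0]; linarith [hτ.2])
  -- Since N_t ≥ n, this makes N_t^p ≥ log(150/τ) in every round, as the noise tail requires.
  refine ⟨max 1 (Real.log (150 / τ) ^ (1 / p)), by positivity, ?_⟩
  intro n hn X _ D _ Θ _ q hq hq1 U _ ν _ R hR
  have hn1 : 1 ≤ n := (le_max_left _ _).trans hn
  have hn2 : Real.log (150 / τ) ^ (1 / p) ≤ n := (le_max_right _ _).trans hn
  set P : EverlastingTO.Params := ⟨τ, β, p, n⟩ with hP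
  have hN : ∀ t, Real.log (150 / P.τ) ≤ P.N t ^ P.p := by
    intro t
    have h1 : n ≤ P.N t := le_mul_of_one_le_right (by linarith)
      (Real.one_le_exp (Nat.cast_nonneg t))
    calc Real.log (150 / τ) = (Real.log (150 / τ) ^ (1 / p)) ^ p := by
          rw [← Real.rpow_mul hlog.le, one_div_mul_cancel hp0.ne', Real.rpow_one]
      _ ≤ P.N t ^ p := Real.rpow_le_rpow (by positivity) (hn2.trans h1) hp0.le
  have hround : ∀ t I, EverlastingTO.interactionLaw D ν {ω | ∃ i < I,
      EverlastingTO.Bad P q (fun i => R i ω.1) D t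
        (EverlastingTO.replies P q (fun i => R i ω.1) ω.2) i} ≤
      ENNReal.ofReal (P.failProb t / 2) := fun t I =>
    EverlastingTO.interactionLaw_bad_le D ν hq hR fun u tape S =>
      EverlastingTO.measure_bad_round_le_half hτ hβ hp hn1 hN hq hq1
        (fun i => (hR i).comp (measurable_const.prodMk measurable_id)) D tape t S I
  -- A bad query is assigned to the round in which it is posed. The cutoff `I` keeps each game
  -- finite; the bounds do not depend on it, so it is removed by monotone continuity.
  have hsub : {ω : U × (ℕ → EverlastingTO.RoundTape X) | ∃ i : ℕ,
      τ < |EverlastingTO.answer P q (fun i => R i ω.1) ω.2 i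
        - ∫ x, EverlastingTO.query P q (fun i => R i ω.1) ω.2 i x ∂D|} ⊆
      ⋃ t : ℕ, ⋃ I : ℕ, {ω | ∃ i < I, EverlastingTO.Bad P q (fun i => R i ω.1) D t
        (EverlastingTO.replies P q (fun i => R i ω.1) ω.2) i} := by
    rintro ω ⟨i, hi⟩
    rw [EverlastingTO.answer_eq, EverlastingTO.query_eq, EverlastingTO.run_eq_replay] at hi
    exact Set.mem_iUnion.2 ⟨_, Set.mem_iUnion.2 ⟨i + 1, i, Nat.lt_succ_self i, rfl, hi⟩⟩
  have hsum : HasSum (fun t => P.failProb t / 2) (β / 2) :=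
    EverlastingTO.Params.hasSum_failProb.div_const 2
  calc _ ≤ ∑' t, EverlastingTO.interactionLaw D ν (⋃ I : ℕ, {ω | ∃ i < I,
        EverlastingTO.Bad P q (fun i => R i ω.1) D t
          (EverlastingTO.replies P q (fun i => R i ω.1) ω.2) i}) :=
        (measure_mono hsub).trans (measure_iUnion_le _)
    _ ≤ ∑' t, ENNReal.ofReal (P.failProb t / 2) := by
        refine ENNReal.tsum_le_tsum fun t => ?_
        rw [Monotone.measure_iUnion]
        · exact iSup_le (hround t)
        · rintro I J hIJ ω ⟨i, hi, hb⟩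
          exact ⟨i, hi.trans_le hIJ, hb⟩
    _ = ENNReal.ofReal (β / 2) := by
        rw [← ENNReal.ofReal_tsum_of_nonneg (fun t => (half_pos
          (EverlastingTO.Params.failProb_pos hβ t)).le) hsum.summable, hsum.tsum_eq]
    -- The factor 1/2 gained in every round makes the inequality strict.
    _ < ENNReal.ofReal β := by
        rw [ENNReal.ofReal_lt_ofReal_iff hβ.1]
        linarith [hβ.1]
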